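/- Let $A$ be an $n\times n$ complex matrix. Then $A$ has a Jordan form $A=QJQ^{-1}$; fix any one, with Jordan blocks of sizes $n_1,\dots,n_u\ge 1$ and eigenvalues $\lambda_1,\dots,\lambda_u$, where blocks with the same eigenvalue are listed from larger to smaller. Let $\mathcal L(A)$ be the lattice of $A$-invariant subspaces. Notation. Let $S_m$ be the $m\times m$ backward shift (ones on the first superdiagonal). For block sizes $s=(s_1,\dots,s_u)$ and powers $k=(k_1,\dots,k_u)$ put $Z_s(k)=\mathrm{diag}(S_{s_1}^{k_1},\dots,S_{s_u}^{k_u})$. For a set $E$ of complex numbers let $s_E$ be the sizes obtained from $\mathbf n=(n_1,\dots,n_u)$ by expanding, for each eigenvalue $\lambda\in E$, every block whose size falls short of the largest block of $\lambda$ by more than one to one less than that largest size; $J_E$ is the Jordan matrix with block sizes $s_E$ and eigenvalues $\lambda_i$, and $\mathbb C^n$ (in Jordan coordinates) is included in the space of $J_E$ as the initial positions of each block. A pair $(k,T)$ represents $N$ over $s_E$ if $T$ is invertible, commutes with $J_E$, maps the first basis vector (the eigenvector) of each block $j$ to a combination of eigenvectors whose rightmost block is $j$, and the image of $Q^{-1}N$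 in the space of $J_E$ is $\ker(Z_{s_E}(k)T^{-1})$. A subspace $N$ is marked if some Jordan basis for $A$ acting on $N$ extends to a Jordan basis for $A$ on $\mathbb C^n$; it is marked at $\lambda$ if its intersection with the generalized eigenspace of $\lambda$ is marked. For $N\in\mathcal L(A)$ let $k_j(N)$ be the largest length of a Jordan chain $v,(J-\lambda_j)v,\dots,(J-\lambda_j)^{k-1}v$ in $Q^{-1}N$ whose eigenvector $(J-\lambda_j)^{k-1}v$ has $j$ as the rightmost block in which it is nonzero ($0$ if there is none). Two invariant subspaces have the same type if they have the same $k(N)=(k_j(N))_j$, and the same refined type if moreover they fail to be marked at the same eigenvalues. Types are ordered by: $t\le t'$ if some subspace of type $t$ lies in some subspace of type $t'$. Let $\hat s$ be the sizes expanded at all eigenvalues. Then: 1. A subspace of $\mathbb C^n$ is $A$-invariant if and only if it is represented over $\hat s$ by some $(k,T)$ with $k\le \mathbf n$ (componentwise); it is invariant and marked if and only if it is represented over the original sizes $\mathbf n$ by some $(k,T)$ with $k\le \mathbf n$. 2. The matrices $Z_{\hat s}(k)$, $k\le \mathbf n$, ordered by inclusion of kernels, form a lattice isomorphic via $k\mapsto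 Z_{\hat s}(k)$ to $\prod_i\{0,\dots,n_i\}$ with the componentwise order. There is an order isomorphism from the types of $A$-invariant subspaces onto this lattice that takes the type of $N$ to the unique matrix $Z_{\hat s}(k)$, $k\le \mathbf n$, for which $N$ is represented over $\hat s$ by some $(k,T)$. 3. $\dim N=\sum_j k_j(N)$ for $N\in\mathcal L(A)$. There is a lattice homomorphism $\prod_i\{0,\dots,n_i\}\to\mathcal L(A)$ whose value at each $k$ is a subspace for which the construction of item 4 gives the unexpanded matrix $Z_{\mathbf n}(k)$. For $N\in\mathcal L(A)$ and every $k\le k(N)$ there is an invariant $N'\subseteq N$ with $k(N')=k$; for $N$ marked and every $k$ with $k(N)\le k\le \mathbf n$ there is a marked invariant $N'\supseteq N$ with $k(N')=k$. 4. (Expanding only where needed.) Every $N\in\mathcal L(A)$ has exactly one matrix $Z_{s_E}(k)$, $k\le \mathbf n$, where $E$ is the set of eigenvalues at which $N$ is not marked, such that $N$ is represented over $s_E$ by some $(k,T)$. Two invariant subspaces have the same such matrix (with its block sizes) if and only if they have the same refined type. This gives a bijection from refined types onto the set of all $Z_{s_E}(k)$ (with their block sizes) with $k\le \mathbf n$ and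 such that for each $\lambda\in E$ there are blocks $i,j$ with eigenvalue $\lambda$, $k_i<n_i$, $k_j<n_j$, $n_i+1<n_j$ and $k_i+1<k_j$. 5. The hyperinvariant subspaces (those invariant under every matrix commuting with $A$) are exactly the invariant subspaces whose matrix in item 4 is an unexpanded $Z_{\mathbf n}(r)$ with $r\le \mathbf n$ and, for all $i\le j$ with $\lambda_i=\lambda_j$, $r_j\le r_i$ and $n_j-r_j\le n_i-r_i$. They form a sublattice of $\mathcal L(A)$, and $N\mapsto r$ is a lattice isomorphism from it onto the lattice of such $r$. -/

import Mathlib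

open Matrix

/-- Positions in a block structure: the pair `⟨i, a⟩` is position `a` (counted from `0`)
of the `i`-th block, which has size `s i`. -/
abbrev BlockIdx {u : ℕ} (s : Fin u → ℕ) : Type := Σ i : Fin u, Fin (s i)

/-- The `m × m` backward shift: ones on the first superdiagonal, zeros elsewhere. -/
def backwardShift (m : ℕ) : Matrix (Fin m) (Fin m) ℂ :=
  Matrix.of fun a b => if (b : ℕ) = (a : ℕ) + 1 then 1 else 0

/-- The Jordan matrix with blocks of sizes `s i` and eigenvalues `μ i`. -/
def jordanMatrix {u : ℕ} (s : Fin u → ℕ) (μ : Fin u → ℂ) :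
    Matrix (BlockIdx s) (BlockIdx s) ℂ :=
  Matrix.blockDiagonal' fun i => μ i • (1 : Matrix (Fin (s i)) (Fin (s i)) ℂ) + backwardShift (s i)

/-- The block diagonal matrix `Z` whose `i`-th diagonal block is the `k i`-th power of the
backward shift of size `s i`. -/
def shiftMatrix {u : ℕ} (s : Fin u → ℕ) (k : Fin u → ℕ) :
    Matrix (BlockIdx s) (BlockIdx s) ℂ :=
  Matrix.blockDiagonal' fun i => backwardShift (s i) ^ k i

/-- The row selection matrix `P` from the block structure `t` to the block structure `s`;
for `s ≤ t` its transpose is the inclusion of the space of the small block structure into the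
space of the large one, as the initial positions of each block. -/
def rowSelection {u : ℕ} (s t : Fin u → ℕ) : Matrix (BlockIdx s) (BlockIdx t) ℂ :=
  Matrix.of fun p q => if p.1 = q.1 ∧ (p.2 : ℕ) = (q.2 : ℕ) then 1 else 0

/-- The lattice of invariant subspaces of a square complex matrix. -/
abbrev invariantLattice {n : ℕ} (A : Matrix (Fin n) (Fin n) ℂ) :
    Sublattice (Submodule ℂ (Fin n → ℂ)) :=
  Module.End.invtSubmodule (Matrix.toLin' A)

/-- The sublattice of hyperinvariant subspaces: those invariant under every matrix that
commutes with `A`. -/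
def hyperinvariantLattice {n : ℕ} (A : Matrix (Fin n) (Fin n) ℂ) :
    Sublattice (Submodule ℂ (Fin n → ℂ)) :=
  ⨅ B : {B : Matrix (Fin n) (Fin n) ℂ // Commute A B}, invariantLattice B.1

/-- The vectors `c ⟨i, a⟩`, `a < m i`, form a Jordan basis for `A` acting on `N`: a basis of `N`
made of Jordan chains `c ⟨i, 0⟩, c ⟨i, 1⟩, …`, each starting with an eigenvector. -/
def IsJordanBasis {n : ℕ} (A : Matrix (Fin n) (Fin n) ℂ) (N : Submodule ℂ (Fin n → ℂ))
    {r : ℕ} (m : Fin r → ℕ) (c : BlockIdx m → Fin n → ℂ) : Prop :=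
  LinearIndependent ℂ c ∧ Submodule.span ℂ (Set.range c) = N ∧
    ∃ ν : Fin r → ℂ, ∀ i : Fin r,
      (∀ h : 0 < m i, A *ᵥ c ⟨i, 0, h⟩ = ν i • c ⟨i, 0, h⟩) ∧
      (∀ (a : ℕ) (h : a + 1 < m i),
        A *ᵥ c ⟨i, a + 1, h⟩ = ν i • c ⟨i, a + 1, h⟩ + c ⟨i, a, Nat.lt_of_succ_lt h⟩)

/-- `N` is marked for `A`: some Jordan basis for `A` acting on `N` can be extended, by adjoining
new vectors, to a Jordan basis for `A` on the whole space. -/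
def IsMarked {n : ℕ} (A : Matrix (Fin n) (Fin n) ℂ) (N : Submodule ℂ (Fin n → ℂ)) : Prop :=
  ∃ (r : ℕ) (m : Fin r → ℕ) (c : BlockIdx m → Fin n → ℂ)
    (t : ℕ) (l : Fin t → ℕ) (b : BlockIdx l → Fin n → ℂ),
    IsJordanBasis A N m c ∧ IsJordanBasis A ⊤ l b ∧ Set.range c ⊆ Set.range b

/-- The eigenvalues at which `N` is not marked: those whose component of `N` (the intersection
with the generalized eigenspace) is not marked. -/
def nonMarkedEigenvalues {n : ℕ} (A : Matrix (Fin n) (Fin n) ℂ)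
    (N : Submodule ℂ (Fin n → ℂ)) : Set ℂ :=
  {z | ¬ IsMarked A (N ⊓ Module.End.maxGenEigenspace (Matrix.toLin' A) z)}

/-- A Jordan form `A = Q J Q⁻¹`; blocks with the same eigenvalue are listed from larger to
smaller. -/
structure JordanForm {n : ℕ} (A : Matrix (Fin n) (Fin n) ℂ) where
  /-- the number of Jordan blocks -/
  u : ℕ
  /-- the sizes of the Jordan blocks -/
  size : Fin u → ℕ
  /-- the eigenvalues of the Jordan blocks -/
  eig : Fin u → ℂ
  size_pos : ∀ i, 0 < size i
  size_anti : ∀ i j, i ≤ j → eig i = eig j → size j ≤ size i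
  /-- the matrix that puts `A` into Jordan form -/
  Q : Matrix (Fin n) (BlockIdx size) ℂ
  /-- the inverse of `Q` -/
  Qinv : Matrix (BlockIdx size) (Fin n) ℂ
  Q_mul_Qinv : Q * Qinv = 1
  Qinv_mul_Q : Qinv * Q = 1
  eq_conj : A = Q * jordanMatrix size eig * Qinv

namespace JordanForm

variable {n : ℕ} {A : Matrix (Fin n) (Fin n) ℂ}

/-- The subspace `Q⁻¹ N` corresponding to `N` in Jordan coordinates. -/
noncomputable def pull (F : JordanForm A) (N : Submodule ℂ (Fin n → ℂ)) :
    Submodule ℂ (BlockIdx F.size → ℂ) :=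
  N.map F.Qinv.mulVecLin

/-- The size of the largest Jordan block with eigenvalue `z`. -/
noncomputable def maxSize (F : JordanForm A) (z : ℂ) : ℕ :=
  (Finset.univ.filter fun i => F.eig i = z).sup F.size

open Classical in
/-- The block sizes after expansion at the eigenvalues in `E`: each block with eigenvalue in `E`
whose size falls short of the largest one by more than one is expanded to one less than the
largest size; all other blocks stay as they are. -/
noncomputable def expandedSize (F : JordanForm A) (E : Set ℂ) (i : Fin F.u) : ℕ :=
  if F.eig i ∈ E then max (F.size i) (F.maxSize (F.eig i) - 1) else F.size i

/-- `N` is obtained, in the expansion of the Jordan matrix at `E`, from the block diagonal matrix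
`Z` with powers `k` and the change of variables `T`.  Here `T` is invertible, commutes with the
expanded Jordan matrix, and maps the first vector of block `j` to a combination of eigenvectors
whose rightmost block is `j`; and `Q⁻¹ N`, viewed in the expanded space, is `ker (Z T⁻¹)`. -/
def Represents (F : JordanForm A) (E : Set ℂ) (k : Fin F.u → ℕ)
    (T : Matrix (BlockIdx (F.expandedSize E)) (BlockIdx (F.expandedSize E)) ℂ)
    (N : Submodule ℂ (Fin n → ℂ)) : Prop :=
  IsUnit T ∧ Commute T (jordanMatrix (F.expandedSize E) F.eig) ∧
    (∀ (i j : Fin F.u) (hi : 0 < F.expandedSize E i) (hj : 0 < F.expandedSize E j),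
      j < i → T ⟨i, 0, hi⟩ ⟨j, 0, hj⟩ = 0) ∧
    (F.pull N).map (rowSelection F.size (F.expandedSize E))ᵀ.mulVecLin =
      LinearMap.ker (shiftMatrix (F.expandedSize E) k * T⁻¹).mulVecLin

/-- The length of the chain of `N` belonging to block `j`: the largest length `k` of a Jordan
chain `v, (J - λ) v, …, (J - λ) ^ (k - 1) v` in `Q⁻¹ N` whose eigenvector `(J - λ) ^ (k - 1) v`
has block `j` as the rightmost block on which it is nonzero (and `0` if there is none). -/
noncomputable def chainLength (F : JordanForm A) (N : Submodule ℂ (Fin n → ℂ))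
    (j : Fin F.u) : ℕ :=
  sSup {k | 0 < k ∧ ∃ v ∈ F.pull N, ∃ w : BlockIdx F.size → ℂ,
    w = ((jordanMatrix F.size F.eig - F.eig j • 1) ^ (k - 1)) *ᵥ v ∧
    (jordanMatrix F.size F.eig - F.eig j • 1) *ᵥ w = 0 ∧
    (∃ a, w ⟨j, a⟩ ≠ 0) ∧ ∀ i, j < i → ∀ a, w ⟨i, a⟩ = 0}

/-- Two invariant subspaces are of the same type when their chains belonging to each Jordan
block have the same length. -/
noncomputable def typeSetoid (F : JordanForm A) : Setoid (invariantLattice A) :=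
  Setoid.ker fun N => F.chainLength N.1

/-- The types of invariant subspaces. -/
abbrev InvType (F : JordanForm A) : Type := Quotient F.typeSetoid

/-- One type is below another when some subspace of the first type lies in some subspace of the
second type. -/
instance (F : JordanForm A) : LE F.InvType where
  le x y := ∃ N N' : invariantLattice A,
    N ≤ N' ∧ Quotient.mk F.typeSetoid N = x ∧ Quotient.mk F.typeSetoid N' = y

/-- The block diagonal matrices of powers of backward shifts, for the block structure expanded at
all eigenvalues, with powers at most the original block sizes. -/
abbrev ZMatrix (F : JordanForm A) : Type :=
  {Z : Matrix (BlockIdx (F.expandedSize Set.univ)) (BlockIdx (F.expandedSize Set.univ)) ℂ //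
    ∃ k ≤ F.size, Z = shiftMatrix (F.expandedSize Set.univ) k}

/-- The matrices `Z` are ordered by inclusion of their kernels. -/
instance (F : JordanForm A) : LE F.ZMatrix where
  le Z Z' := LinearMap.ker Z.1.mulVecLin ≤ LinearMap.ker Z'.1.mulVecLin

/-- Two invariant subspaces are of the same refined type when they are of the same type and
are not marked at the same eigenvalues. -/
noncomputable def refinedSetoid (F : JordanForm A) : Setoid (invariantLattice A) :=
  Setoid.ker fun N => (F.chainLength N.1, nonMarkedEigenvalues A N.1)

/-- The matrix `Z`, together with its block sizes, is the one constructed for `N`: the Jordan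
matrix is expanded exactly at the eigenvalues where `N` is not marked. -/
def Produces (F : JordanForm A) (N : Submodule ℂ (Fin n → ℂ))
    (Z : Σ s : Fin F.u → ℕ, Matrix (BlockIdx s) (BlockIdx s) ℂ) : Prop :=
  ∃ k ≤ F.size, (∃ T, F.Represents (nonMarkedEigenvalues A N) k T N) ∧
    Z = ⟨F.expandedSize (nonMarkedEigenvalues A N), shiftMatrix _ k⟩

/-- The explicit list of all matrices `Z`: the powers `k` are at most the block sizes, and blocks
may be expanded at an eigenvalue `z` when two of its blocks `i`, `j`, both of them with a power
below the block size, differ in size and in power by more than one, in the same direction. -/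
def zList (F : JordanForm A) : Set (Σ s : Fin F.u → ℕ, Matrix (BlockIdx s) (BlockIdx s) ℂ) :=
  {Z | ∃ k ≤ F.size, ∃ E : Set ℂ,
    (∀ z ∈ E, ∃ i j, F.eig i = z ∧ F.eig j = z ∧ k i < F.size i ∧ k j < F.size j ∧
      F.size i + 1 < F.size j ∧ k i + 1 < k j) ∧
    Z = ⟨F.expandedSize E, shiftMatrix _ k⟩}

/-- The powers `r` of hyperinvariant subspaces: among the blocks of each eigenvalue, listed from
larger to smaller, both the powers `r` and the differences `size - r` are non-increasing. -/
def hyperPowers (F : JordanForm A) : Sublattice (Fin F.u → ℕ) where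
  carrier := {r | r ≤ F.size ∧ ∀ i j, i ≤ j → F.eig i = F.eig j →
    r j ≤ r i ∧ F.size j - r j ≤ F.size i - r i}
  supClosed' := by
    rintro r ⟨hr, hr'⟩ q ⟨hq, hq'⟩
    refine ⟨sup_le hr hq, fun i j hij he => ?_⟩
    have h1 := hr' i j hij he
    have h2 := hq' i j hij he
    simp only [Pi.sup_apply]
    omega
  infClosed' := by
    rintro r ⟨hr, hr'⟩ q ⟨hq, hq'⟩
    refine ⟨inf_le_left.trans hr, fun i j hij he => ?_⟩
    have h1 := hr' i j hij he
    have h2 := hq' i j hij he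
    simp only [Pi.inf_apply]
    omega

end JordanForm

/-!
Extended by zero, the Jordan coordinates identify `A` with the Jordan operator all of whose blocks
are infinite, so that subspaces for different block sizes live in the same space. Order the unit
vectors first by position within their block, then by block. The lead of a vector supported at one
eigenvalue is its last nonzero entry. The leads of the vectors in an invariant subspace `N` of
finite dimension occupy the first `k j` positions of each block `j`, since the Jordan operator minus
the eigenvalue moves leads down their blocks. An invariant subspace inside another one with the same
`k` is equal to it.

A matrix `T` that represents `N` sends the last unit vector of each block `j` of size `s j` to a
vector `t j` leading in the last position of block `j` such that the chain of `t j` contains a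
vector of `N` leading at position `k j - 1`. Conversely such vectors `t j` span a new system of
Jordan coordinates in which `N` is given by the powers `k`. They exist over the original sizes
exactly if `N` is marked, and eigenvalue by eigenvalue. They exist for all `N` after the expansion,
because a block of size one less than the largest of its eigenvalue leaves enough room above the
entries of a vector of `N` to divide it by the required power of the shift.

At an eigenvalue where no two blocks have the gap of item 4, every chain of `N` can be chosen, up to
vectors of `N`, with enough room in the unexpanded blocks. Where such a gap `i, j` exists, adding a
shifted copy of block `j` in block `i` to a standard subspace destroys markedness without changing
`k`. A hyperinvariant subspace contains with a vector the images of its entries under all moves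
between blocks with the same eigenvalue, hence is spanned by initial segments of the blocks.
-/

/-- Families of sequences indexed by the Jordan blocks.  They contain the coordinate vectors of
Jordan matrices of all block sizes, extended by zero, so that subspaces for different sizes can be
compared. -/
abbrev BlockSeq (K ι : Type*) : Type _ := ι → ℕ → K

namespace BlockSeq

section Supported

variable {K ι : Type*} [Field K] {P Q : ι → ℕ → Prop} {v : BlockSeq K ι}

/-- The families whose nonzero entries are at positions satisfying `P`. -/
def supported (P : ι → ℕ → Prop) : Submodule K (BlockSeq K ι) where
  carrier := {v | ∀ i a, ¬ P i a → v i a = 0}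
  add_mem' hv hw i a h := by simp [hv i a h, hw i a h]
  zero_mem' _ _ _ := rfl
  smul_mem' c v hv i a h := by simp [hv i a h]

lemma mem_supported : v ∈ supported P ↔ ∀ i a, v i a ≠ 0 → P i a :=
  forall₂_congr fun _ _ => not_imp_comm

lemma supported_mono (h : ∀ i a, P i a → Q i a) :
    (supported P : Submodule K (BlockSeq K ι)) ≤ supported Q :=
  fun _ hv i a ha => hv i a (mt (h i a) ha)

/-- The families whose `i`-th sequence vanishes from position `s i` on. -/
abbrev bounded (s : ι → ℕ) : Submodule K (BlockSeq K ι) := supported fun i a => a < s i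

lemma bounded_mono {r s : ι → ℕ} (h : r ≤ s) :
    (bounded r : Submodule K (BlockSeq K ι)) ≤ bounded s :=
  supported_mono fun i _ ha => ha.trans_le (h i)

/-- The families supported on the blocks with eigenvalue `z`. -/
abbrev primary (μ : ι → K) (z : K) : Submodule K (BlockSeq K ι) := supported fun i _ => μ i = z

open Classical in
/-- The projection that keeps the entries at positions satisfying `P`. -/
noncomputable def restrict (P : ι → ℕ → Prop) : Module.End K (BlockSeq K ι) where
  toFun v i a := if P i a then v i a else 0
  map_add' v w := by ext i a; simp [ite_add_zero]
  map_smul' c v := by ext i a; simp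

lemma restrict_apply_of_pos {i : ι} {a : ℕ} (h : P i a) : restrict P v i a = v i a := if_pos h

lemma restrict_apply_of_neg {i : ι} {a : ℕ} (h : ¬ P i a) : restrict P v i a = 0 := if_neg h

lemma restrict_mem_supported (P : ι → ℕ → Prop) (v : BlockSeq K ι) : restrict P v ∈ supported P :=
  fun _ _ => restrict_apply_of_neg

lemma restrict_mem (h : v ∈ supported Q) : restrict P v ∈ supported Q := by
  intro i a ha
  by_cases hP : P i a
  · rw [restrict_apply_of_pos hP, h i a ha]
  · exact restrict_apply_of_neg hP

lemma restrict_eq_self (h : v ∈ supported P) : restrict P v = v := by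
  ext i a
  by_cases hP : P i a
  · exact restrict_apply_of_pos hP
  · rw [restrict_apply_of_neg hP, h i a hP]

lemma restrict_eq_zero (h : v ∈ supported fun i a => ¬ P i a) : restrict P v = 0 := by
  ext i a
  by_cases hP : P i a
  · rw [restrict_apply_of_pos hP, h i a (not_not.2 hP)]
    rfl
  · exact restrict_apply_of_neg hP

open Classical in
lemma sum_restrict_primary [Fintype ι] (μ : ι → K) (v : BlockSeq K ι) :
    ∑ z ∈ Finset.univ.image μ, restrict (fun i _ => μ i = z) v = v := by
  ext i a
  simp [Finset.sum_apply, restrict, Finset.sum_ite_eq]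

open Classical in
/-- The unit vector at position `a` of block `j`. -/
noncomputable def unit (j : ι) (a : ℕ) : BlockSeq K ι := Pi.single j (Pi.single a 1)

@[simp]
lemma unit_self (j : ι) (a : ℕ) : (unit j a : BlockSeq K ι) j a = 1 := by simp [unit]

lemma unit_mem_supported {j : ι} {a : ℕ} (h : P j a) :
    (unit j a : BlockSeq K ι) ∈ supported P := by
  classical
  intro i b hb
  by_cases hi : i = j
  · subst hi
    rw [unit, Pi.single_eq_same, Pi.single_eq_of_ne fun hba => hb (by rwa [hba])]
  · rw [unit, Pi.single_eq_of_ne hi]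
    rfl

lemma of_unit_mem_supported {j : ι} {a : ℕ} (h : (unit j a : BlockSeq K ι) ∈ supported P) :
    P j a :=
  mem_supported.1 h j a (by simp)

lemma eq_sum_unit [Fintype ι] {s : ι → ℕ} (hv : v ∈ bounded s) :
    v = ∑ i, ∑ a ∈ Finset.range (s i), v i a • unit i a := by
  classical
  ext i a
  simp only [Finset.sum_apply, Pi.smul_apply, smul_eq_mul, unit]
  rw [Finset.sum_eq_single i (fun j _ hj => ?_) (by simp)]
  · simp only [Pi.single_eq_same, Pi.single_apply, mul_ite, mul_one, mul_zero, Finset.sum_ite_eq,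
      Finset.mem_range]
    exact (ite_eq_left_iff.2 fun h => (hv i a h).symm).symm
  · simp [Pi.single_eq_of_ne hj.symm]

lemma mem_of_unit_mem [Finite ι] {s : ι → ℕ} {W : Submodule K (BlockSeq K ι)}
    (hv : v ∈ bounded s) (h : ∀ i a, v i a ≠ 0 → unit i a ∈ W) : v ∈ W := by
  cases nonempty_fintype ι
  rw [eq_sum_unit hv]
  refine Submodule.sum_mem _ fun i _ => Submodule.sum_mem _ fun a _ => ?_
  by_cases h0 : v i a = 0
  · simp [h0]
  · exact W.smul_mem _ (h i a h0)

end Supported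

section Shift

variable {K ι : Type*} [Field K] {v : BlockSeq K ι}

/-- Moves all entries `p` positions towards the beginning, deleting the first `p`. -/
def shift (p : ℕ) : Module.End K (BlockSeq K ι) where
  toFun v i a := v i (a + p)
  map_add' _ _ := rfl
  map_smul' _ _ := rfl

@[simp]
lemma shift_apply (p : ℕ) (v : BlockSeq K ι) (i : ι) (a : ℕ) : shift p v i a = v i (a + p) := rfl

lemma shift_shift (p q : ℕ) (v : BlockSeq K ι) : shift p (shift q v) = shift (p + q) v := by
  ext i a
  simp only [shift_apply, add_assoc]

/-- Moves all entries `p` positions away from the beginning, filling in zeros. -/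
def unshift (p : ℕ) (v : BlockSeq K ι) : BlockSeq K ι := fun i a => if p ≤ a then v i (a - p) else 0

lemma shift_unshift (p : ℕ) (v : BlockSeq K ι) : shift p (unshift p v) = v := by
  ext i a
  simp [unshift]

lemma unshift_add (p : ℕ) (v : BlockSeq K ι) (i : ι) (a : ℕ) : unshift p v i (a + p) = v i a := by
  simp [unshift]

lemma unshift_mem_supported {p : ℕ} {P : ι → ℕ → Prop} :
    unshift p v ∈ supported P ↔ v ∈ supported fun i a => P i (a + p) := by
  refine ⟨fun h i a ha => (unshift_add p v i a).symm.trans (h _ _ ha), fun h i a ha => ?_⟩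
  unfold unshift
  split_ifs with hp
  · exact h i _ (by simpa only [Nat.sub_add_cancel hp] using ha)
  · rfl

lemma shift_mem_supported {p : ℕ} {P Q : ι → ℕ → Prop} (h : ∀ i a, P i (a + p) → Q i a)
    (hv : v ∈ supported P) : shift p v ∈ supported Q :=
  fun i a ha => hv i (a + p) (mt (h i a) ha)

lemma shift_mem_bounded {s : ι → ℕ} (p : ℕ) (hv : v ∈ bounded s) : shift p v ∈ bounded s :=
  shift_mem_supported (fun _ _ => lt_of_le_of_lt (Nat.le_add_right _ _)) hv

lemma shift_mem_primary {μ : ι → K} {z : K} (p : ℕ) (hv : v ∈ primary μ z) :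
    shift p v ∈ primary μ z :=
  shift_mem_supported (fun _ _ => id) hv

lemma shift_unit {j : ι} {p a : ℕ} (h : p ≤ a) :
    shift p (unit j a : BlockSeq K ι) = unit j (a - p) := by
  classical
  ext i b
  by_cases hi : i = j
  · subst hi
    simp only [shift_apply, unit, Pi.single_eq_same, Pi.single_apply, eq_tsub_iff_add_eq_of_le h]
  · simp [unit, Pi.single_eq_of_ne hi]

/-- The Jordan operator with eigenvalue `μ i` on the `i`-th block; all blocks are infinite. -/
def jordan (μ : ι → K) : Module.End K (BlockSeq K ι) where
  toFun v i a := μ i * v i a + v i (a + 1)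
  map_add' v w := by ext i a; simp only [Pi.add_apply]; ring
  map_smul' c v := by ext i a; simp only [Pi.smul_apply, smul_eq_mul, RingHom.id_apply]; ring

lemma jordan_apply (μ : ι → K) (v : BlockSeq K ι) (i : ι) (a : ℕ) :
    jordan μ v i a = μ i * v i a + v i (a + 1) := rfl

lemma jordan_of_mem_primary {μ : ι → K} {z : K} (hv : v ∈ primary μ z) :
    jordan μ v = z • v + shift 1 v := by
  ext i a
  by_cases hi : μ i = z
  · simp [jordan_apply, hi]
  · simp [jordan_apply, hv i _ hi]

lemma jordan_mem_bounded {μ : ι → K} {s : ι → ℕ} (hv : v ∈ bounded s) :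
    jordan μ v ∈ bounded s := by
  intro i a ha
  rw [jordan_apply, hv i a ha, hv i (a + 1) (by omega), mul_zero, add_zero]

lemma shift_mem {μ : ι → K} {z : K} {N : Submodule K (BlockSeq K ι)}
    (hN : ∀ v ∈ N, jordan μ v ∈ N) (hv : v ∈ N) (hz : v ∈ primary μ z) (p : ℕ) :
    shift p v ∈ N := by
  induction p with
  | zero => exact hv
  | succ p ih =>
    have h := jordan_of_mem_primary (shift_mem_primary p hz)
    rw [add_comm, ← shift_shift, ← sub_eq_iff_eq_add'.2 h]
    exact N.sub_mem (hN _ ih) (N.smul_mem z ih)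

end Shift

section Lead

variable {K ι : Type*} [Field K] [LinearOrder ι] {μ : ι → K} {i j : ι} {a b : ℕ}
  {v w : BlockSeq K ι}

/-- `v` is supported at one eigenvalue, and its last nonzero entry is at position `a` of block `j`,
where the entries are ordered first by position, then by block. For `a = 0` this says that `v` is
an eigenvector and `j` is the rightmost block on which it is nonzero. -/
structure HasLead (μ : ι → K) (j : ι) (a : ℕ) (v : BlockSeq K ι) : Prop where
  ne_zero : v j a ≠ 0
  mem_supported : v ∈ supported fun i b => μ i = μ j ∧ toLex (b, i) ≤ toLex (a, j)

namespace HasLead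

lemma mem_primary (h : HasLead μ j a v) : v ∈ primary μ (μ j) :=
  supported_mono (fun _ _ => And.left) h.mem_supported

lemma toLex_le (h : HasLead μ j a v) (hb : v i b ≠ 0) : toLex (b, i) ≤ toLex (a, j) :=
  (BlockSeq.mem_supported.1 h.mem_supported i b hb).2

lemma lt_or_eq (h : HasLead μ j a v) (hb : v i b ≠ 0) : b < a ∨ b = a ∧ i ≤ j :=
  Prod.Lex.toLex_le_toLex.1 (h.toLex_le hb)

lemma lt_succ (h : HasLead μ j a v) (hb : v i b ≠ 0) : b < a + 1 := by
  have := h.lt_or_eq hb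
  omega

lemma unique (h : HasLead μ j a v) (h' : HasLead μ i b v) : j = i ∧ a = b := by
  have := (h'.toLex_le h.ne_zero).antisymm (h.toLex_le h'.ne_zero)
  simp_all

protected lemma shift (h : HasLead μ j (a + b) v) : HasLead μ j a (shift b v) where
  ne_zero := h.ne_zero
  mem_supported := shift_mem_supported (fun i c => by simp [Prod.Lex.toLex_le_toLex])
    h.mem_supported

lemma of_shift (h : HasLead μ j a (shift b v))
    (hv : v ∈ supported fun i c => μ i = μ j ∧ c < a + b + 1) : HasLead μ j (a + b) v where
  ne_zero := h.ne_zero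
  mem_supported := BlockSeq.mem_supported.2 fun i c hc => by
    obtain ⟨hi, hca⟩ := BlockSeq.mem_supported.1 hv i c hc
    refine ⟨hi, Prod.Lex.toLex_le_toLex.2 ?_⟩
    rcases (Nat.lt_succ_iff.1 hca).lt_or_eq with hlt | rfl
    · exact Or.inl hlt
    · have := h.lt_or_eq (i := i) (b := a) hc
      simp_all

lemma of_sub_mem (h : HasLead μ j a v)
    (hw : v - w ∈ supported fun i b => μ i = μ j ∧ toLex (b, i) < toLex (a, j)) :
    HasLead μ j a w where
  ne_zero := by
    rw [← sub_sub_cancel v w, Pi.sub_apply, Pi.sub_apply, hw j a fun h => lt_irrefl _ h.2, sub_zero]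
    exact h.ne_zero
  mem_supported := by
    rw [← sub_sub_cancel v w]
    exact Submodule.sub_mem _ h.mem_supported (supported_mono (fun _ _ h => ⟨h.1, h.2.le⟩) hw)

protected lemma smul {c : K} (hc : c ≠ 0) (h : HasLead μ j a v) : HasLead μ j a (c • v) where
  ne_zero := mul_ne_zero hc h.ne_zero
  mem_supported := Submodule.smul_mem _ c h.mem_supported

lemma sub_smul_mem (hv : HasLead μ j a v) (hw : HasLead μ j a w) :
    v - (v j a / w j a) • w ∈ supported fun i b => μ i = μ j ∧ toLex (b, i) < toLex (a, j) := by
  refine BlockSeq.mem_supported.2 fun i b hb => ?_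
  obtain ⟨hi, hle⟩ := BlockSeq.mem_supported.1
    (Submodule.sub_mem _ hv.mem_supported (Submodule.smul_mem _ (v j a / w j a) hw.mem_supported))
    i b hb
  refine ⟨hi, hle.lt_of_ne fun heq => hb ?_⟩
  obtain ⟨rfl, rfl⟩ := Prod.mk.inj (toLex_inj.1 heq)
  simp [hw.ne_zero]

end HasLead

lemma hasLead_unit (μ : ι → K) (j : ι) (a : ℕ) : HasLead μ j a (unit j a) where
  ne_zero := by simp
  mem_supported := unit_mem_supported ⟨rfl, le_rfl⟩

lemma exists_hasLead [Finite ι] {s : ι → ℕ} {z : K} (hs : v ∈ bounded s) (hz : v ∈ primary μ z)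
    (h0 : v ≠ 0) : ∃ j a, μ j = z ∧ HasLead μ j a v := by
  have hfin : {p : ℕ ×ₗ ι | v (ofLex p).2 (ofLex p).1 ≠ 0}.Finite := by
    refine (Set.finite_iUnion fun i => (Set.finite_Iio (s i)).image fun a => toLex (a, i)).subset
      fun p hp => ?_
    exact Set.mem_iUnion.2 ⟨(ofLex p).2, (ofLex p).1, mem_supported.1 hs _ _ hp, rfl⟩
  have hne : {p : ℕ ×ₗ ι | v (ofLex p).2 (ofLex p).1 ≠ 0}.Nonempty := by
    obtain ⟨i, hi⟩ := Function.ne_iff.1 h0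
    obtain ⟨a, ha⟩ := Function.ne_iff.1 hi
    exact ⟨toLex (a, i), ha⟩
  obtain ⟨p, hp, hmax⟩ := Set.exists_max_image _ id hfin hne
  have hpz := mem_supported.1 hz _ _ hp
  exact ⟨(ofLex p).2, (ofLex p).1, hpz, hp, mem_supported.2 fun i a hia =>
    ⟨(mem_supported.1 hz i a hia).trans hpz.symm, hmax (toLex (a, i)) hia⟩⟩

variable {s k l : ι → ℕ} {M N : Submodule K (BlockSeq K ι)}

/-- Elimination: subtracting a multiple of a vector of `M` with the same lead moves the lead of a
vector of `N` down. -/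
lemma mem_of_hasLead [Finite ι] (hMN : M ≤ N) (hs : N ≤ bounded s)
    (hlead : ∀ j a, (∃ v ∈ N, HasLead μ j a v) → ∃ v ∈ M, HasLead μ j a v) {z : K}
    (hv : v ∈ N) (hz : v ∈ primary μ z) : v ∈ M := by
  suffices h : ∀ p : ℕ ×ₗ ι, ∀ v ∈ N, ∀ j a, toLex (a, j) = p → HasLead μ j a v → v ∈ M by
    rcases eq_or_ne v 0 with rfl | h0
    · exact M.zero_mem
    · obtain ⟨j, a, -, hl⟩ := exists_hasLead (hs hv) hz h0
      exact h _ v hv j a rfl hl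
  intro p
  induction p using WellFoundedLT.induction with | ind p ih
  rintro v hv j a rfl hl
  obtain ⟨w, hw, hlw⟩ := hlead j a ⟨v, hv, hl⟩
  set c := v j a / w j a
  have hlower := hl.sub_smul_mem hlw
  have hmem : v - c • w ∈ N := N.sub_mem hv (N.smul_mem c (hMN hw))
  refine (M.sub_mem_iff_left (M.smul_mem c hw)).1 ?_
  rcases eq_or_ne (v - c • w) 0 with h0 | h0
  · exact h0 ▸ M.zero_mem
  · obtain ⟨i, b, -, hi⟩ := exists_hasLead (hs hmem)
      (supported_mono (fun _ _ => And.left) hlower) h0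
    exact ih _ (mem_supported.1 hlower i b hi.ne_zero).2 _ hmem i b rfl hi

/-- `N` contains with a vector its components at all eigenvalues. -/
def IsGraded (μ : ι → K) (N : Submodule K (BlockSeq K ι)) : Prop :=
  ∀ v ∈ N, ∀ z, restrict (fun i _ => μ i = z) v ∈ N

omit [LinearOrder ι] in
lemma isGraded_supported (μ : ι → K) (P : ι → ℕ → Prop) : IsGraded μ (supported P) :=
  fun _ hv _ => restrict_mem hv

/-- The positions at which vectors of `N` can have their lead are the first `k j` positions of each
block `j`. -/
def HasProfile (μ : ι → K) (N : Submodule K (BlockSeq K ι)) (k : ι → ℕ) : Prop :=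
  ∀ j a, (∃ v ∈ N, HasLead μ j a v) ↔ a < k j

lemma HasProfile.mono (hM : HasProfile μ M k) (hN : HasProfile μ N l) (h : M ≤ N) : k ≤ l :=
  fun j => le_of_forall_lt fun a ha =>
    let ⟨v, hv, hl⟩ := (hM j a).2 ha
    (hN j a).1 ⟨v, h hv, hl⟩

lemma HasProfile.unique (h : HasProfile μ N k) (h' : HasProfile μ N l) : k = l :=
  (h.mono h' le_rfl).antisymm (h'.mono h le_rfl)

lemma HasProfile.le (h : HasProfile μ N k) (hs : N ≤ bounded s) : k ≤ s :=
  fun j => le_of_forall_lt fun a ha =>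
    let ⟨_, hv, hl⟩ := (h j a).2 ha
    mem_supported.1 (hs hv) j a hl.ne_zero

lemma hasProfile_bounded (μ : ι → K) (k : ι → ℕ) : HasProfile μ (bounded k) k :=
  fun j a => ⟨fun ⟨_, hv, hl⟩ => mem_supported.1 hv j a hl.ne_zero,
    fun ha => ⟨unit j a, unit_mem_supported ha, hasLead_unit μ j a⟩⟩

lemma HasProfile.eq_of_le [Finite ι] (hM : HasProfile μ M k) (hN : HasProfile μ N k) (hMN : M ≤ N)
    (hs : N ≤ bounded s) (hgr : IsGraded μ N) : M = N := by
  cases nonempty_fintype ι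
  refine hMN.antisymm fun v hv => ?_
  rw [← sum_restrict_primary μ v]
  exact M.sum_mem fun z _ => mem_of_hasLead hMN hs (fun j a => (hN j a).trans (hM j a).symm |>.1)
    (hgr v hv z) (restrict_mem_supported _ v)

lemma hasProfile_sSup (hN : ∀ v ∈ N, jordan μ v ∈ N) (hs : N ≤ bounded s) :
    HasProfile μ N fun j => sSup {k | 0 < k ∧ ∃ v ∈ N, HasLead μ j (k - 1) v} := by
  intro j a
  set S := {k | 0 < k ∧ ∃ v ∈ N, HasLead μ j (k - 1) v}
  have hbdd : BddAbove S := ⟨s j, fun k ⟨_, _, hv, hl⟩ => by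
    have := mem_supported.1 (hs hv) j _ hl.ne_zero
    omega⟩
  refine ⟨fun ⟨v, hv, hl⟩ => Nat.lt_of_succ_le <| le_csSup hbdd ⟨a.succ_pos, v, hv, hl⟩,
    fun (ha : a < sSup S) => ?_⟩
  have hne : S.Nonempty := Set.nonempty_iff_ne_empty.2 fun h => by simp [h] at ha
  obtain ⟨-, v, hv, hl⟩ := Nat.sSup_mem hne hbdd
  rw [show sSup S - 1 = a + (sSup S - 1 - a) by omega] at hl
  exact ⟨_, shift_mem hN hv hl.mem_primary _, hl.shift⟩

end Lead

section Coord

variable {K ι E : Type*} [Field K] [AddCommGroup E] [Module K E] {f : Module.End K E} {s : ι → ℕ}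
  {μ : ι → K} {φ : E →ₗ[K] BlockSeq K ι} {z : K} {p a : ℕ} {i j : ι} {v w : E}

lemma jordan_mem_supported_iff {y : BlockSeq K ι} (hy : y ∈ bounded s) :
    jordan μ y ∈ supported (fun i a => μ i = 0 ∧ a < p) ↔
      y ∈ supported fun i a => μ i = 0 ∧ a < p + 1 := by
  refine ⟨fun h i a hia => ?_, fun h => ?_⟩
  · by_cases hi : μ i = 0
    · rcases a with _ | a
      · exact absurd ⟨hi, p.succ_pos⟩ hia
      · have := h i a fun h => hia ⟨h.1, Nat.succ_lt_succ h.2⟩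
        rwa [jordan_apply, hi, zero_mul, zero_add] at this
    · have hstep (b) (hb : y i (b + 1) = 0) : y i b = 0 := by
        have := h i b fun h => hi h.1
        rw [jordan_apply, hb, add_zero] at this
        exact (mul_eq_zero.1 this).resolve_left hi
      have hdown (t) (ht : y i (a + t) = 0) : y i a = 0 := by
        induction t with
        | zero => exact ht
        | succ t ih => exact ih (hstep _ ht)
      exact hdown (s i) (hy i _ (by omega))
  · rw [jordan_of_mem_primary (supported_mono (fun _ _ => And.left) h), zero_smul, zero_add]
    exact shift_mem_supported (fun i a h => ⟨h.1, Nat.succ_lt_succ_iff.1 h.2⟩) h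

/-- `φ` identifies the endomorphism `f` with the Jordan operator whose blocks have sizes `s` and
eigenvalues `μ`. -/
structure IsCoord (f : Module.End K E) (s : ι → ℕ) (μ : ι → K) (φ : E →ₗ[K] BlockSeq K ι) :
    Prop where
  injective : Function.Injective φ
  range_eq : LinearMap.range φ = bounded s
  map_apply : ∀ v, φ (f v) = jordan μ (φ v)

namespace IsCoord

lemma mem_bounded (h : IsCoord f s μ φ) (v : E) : φ v ∈ bounded s :=
  h.range_eq ▸ LinearMap.mem_range_self φ v

lemma exists_eq (h : IsCoord f s μ φ) {y : BlockSeq K ι} (hy : y ∈ bounded s) : ∃ v, φ v = y :=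
  LinearMap.mem_range.1 (h.range_eq ▸ hy)

lemma map_le (h : IsCoord f s μ φ) (N : Submodule K E) : N.map φ ≤ bounded s :=
  h.range_eq ▸ LinearMap.map_le_range

lemma map_comap (h : IsCoord f s μ φ) {N : Submodule K (BlockSeq K ι)} (hN : N ≤ bounded s) :
    (N.comap φ).map φ = N :=
  Submodule.map_comap_eq_of_le (h.range_eq ▸ hN)

lemma exists_commute_lift (h : IsCoord f s μ φ) {ψ : E →ₗ[K] BlockSeq K ι}
    (hψ : ∀ v, ψ v ∈ bounded s) (hjordan : ∀ v, ψ (f v) = jordan μ (ψ v)) :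
    ∃ g, Commute f g ∧ ∀ v, φ (g v) = ψ v := by
  let g : Module.End K E := (LinearEquiv.ofInjective φ h.injective).symm ∘ₗ
    ψ.codRestrict (LinearMap.range φ) fun v => h.range_eq ▸ hψ v
  have hg (v : E) : φ (g v) = ψ v :=
    LinearEquiv.ofInjective_symm_apply (h := h.injective) _ ⟨ψ v, h.range_eq ▸ hψ v⟩
  refine ⟨g, LinearMap.ext fun v => h.injective ?_, hg⟩
  rw [Module.End.mul_apply, Module.End.mul_apply, h.map_apply, hg, hg, hjordan]

lemma sub_smul (h : IsCoord f s μ φ) (z : K) : IsCoord (f - z • 1) s (fun i => μ i - z) φ where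
  injective := h.injective
  range_eq := h.range_eq
  map_apply v := by
    ext i a
    simp only [LinearMap.sub_apply, LinearMap.smul_apply, Module.End.one_apply, map_sub, map_smul,
      h.map_apply, Pi.sub_apply, Pi.smul_apply, jordan_apply, smul_eq_mul]
    ring

lemma pow_eq_zero_iff (h : IsCoord f s μ φ) :
    ((f - z • 1) ^ p) v = 0 ↔ φ v ∈ supported fun i a => μ i = z ∧ a < p := by
  induction p generalizing v with
  | zero => simp [← map_eq_zero_iff φ h.injective, funext_iff, supported]
  | succ p ih =>
    rw [pow_succ, Module.End.mul_apply, ih, (h.sub_smul z).map_apply]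
    simpa only [sub_eq_zero] using
      jordan_mem_supported_iff (μ := fun i => μ i - z) (p := p) (h.mem_bounded v)

lemma map_sub_pow (h : IsCoord f s μ φ) (hv : φ v ∈ primary μ z) (p : ℕ) :
    φ (((f - z • 1) ^ p) v) = shift p (φ v) := by
  induction p with
  | zero => rfl
  | succ p ih =>
    rw [pow_succ', Module.End.mul_apply, LinearMap.sub_apply, map_sub, h.map_apply, ih,
      jordan_of_mem_primary (shift_mem_primary p hv), shift_shift, add_comm 1 p]
    simp [ih]

lemma mem_maxGenEigenspace_iff [Finite ι] (h : IsCoord f s μ φ) :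
    v ∈ f.maxGenEigenspace z ↔ φ v ∈ primary μ z := by
  cases nonempty_fintype ι
  rw [Module.End.mem_maxGenEigenspace]
  refine ⟨fun ⟨k, hk⟩ => supported_mono (fun _ _ => And.left) (h.pow_eq_zero_iff.1 hk),
    fun hz => ⟨Finset.univ.sup s, h.pow_eq_zero_iff.2 <| mem_supported.2 fun i a hne =>
      ⟨mem_supported.1 hz i a hne, ?_⟩⟩⟩
  exact (mem_supported.1 (h.mem_bounded v) i a hne).trans_le (Finset.le_sup (Finset.mem_univ i))

lemma iSup_maxGenEigenspace_eq_top [Finite ι] (h : IsCoord f s μ φ) :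
    ⨆ z, f.maxGenEigenspace z = ⊤ := by
  classical
  cases nonempty_fintype ι
  refine eq_top_iff.2 fun v _ => ?_
  choose w hw using fun z => h.exists_eq (restrict_mem (P := fun i _ => μ i = z) (h.mem_bounded v))
  have hv : v = ∑ z ∈ Finset.univ.image μ, w z := h.injective <| by
    rw [map_sum, Finset.sum_congr rfl fun z _ => hw z, sum_restrict_primary]
  rw [hv]
  exact Submodule.sum_mem _ fun z _ => Submodule.mem_iSup_of_mem z <|
    h.mem_maxGenEigenspace_iff.2 (hw z ▸ restrict_mem_supported _ _)

lemma isGraded_map [Finite ι] [FiniteDimensional K E] (h : IsCoord f s μ φ) {N : Submodule K E}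
    (hN : N ∈ f.invtSubmodule) : IsGraded μ (N.map φ) := by
  rintro _ ⟨v, hv, rfl⟩ z
  rw [SetLike.mem_coe, Submodule.eq_iSup_inf_genEigenspace (f := f) (p := N) ⊤ (fun x hx => hN hx)
    h.iSup_maxGenEigenspace_eq_top] at hv
  suffices hle : ⨆ w, N ⊓ f.maxGenEigenspace w ≤
      (N.map φ).comap (restrict (fun i _ => μ i = z) ∘ₗ φ) from hle hv
  refine iSup_le fun w x hx => ?_
  have hxw := h.mem_maxGenEigenspace_iff.1 hx.2
  rw [Submodule.mem_comap, LinearMap.comp_apply]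
  by_cases hw : w = z
  · rw [restrict_eq_self (hw ▸ hxw)]
    exact Submodule.mem_map_of_mem hx.1
  · rw [restrict_eq_zero (supported_mono (fun i _ (hi : μ i = w) => hi.trans_ne hw) hxw)]
    exact Submodule.zero_mem _

lemma mem_invtSubmodule_iff (h : IsCoord f s μ φ) {N : Submodule K E} :
    N ∈ f.invtSubmodule ↔ ∀ y ∈ N.map φ, jordan μ y ∈ N.map φ := by
  simp only [Submodule.mem_map, forall_exists_index, and_imp, forall_apply_eq_imp_iff₂,
    ← h.map_apply, h.injective.eq_iff, exists_eq_right]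
  rfl

section Commute

variable {g : Module.End K E}

lemma map_commute_mem_supported (h : IsCoord f s μ φ) (hg : Commute f g)
    (hv : φ v ∈ supported fun i a => μ i = z ∧ a < p) :
    φ (g v) ∈ supported fun i a => μ i = z ∧ a < p := by
  have hpow : Commute ((f - z • 1) ^ p) g :=
    (hg.sub_left ((Commute.one_left g).smul_left z)).pow_left p
  rw [← h.pow_eq_zero_iff] at hv ⊢
  rw [← Module.End.mul_apply, hpow.eq, Module.End.mul_apply, hv, map_zero]

lemma map_commute_mem_primary [Finite ι] (h : IsCoord f s μ φ) (hg : Commute f g)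
    (hv : φ v ∈ primary μ z) : φ (g v) ∈ primary μ z := by
  obtain ⟨p, hp⟩ := (Module.End.mem_maxGenEigenspace ..).1 (h.mem_maxGenEigenspace_iff.2 hv)
  exact supported_mono (fun _ _ => And.left)
    (h.map_commute_mem_supported hg (h.pow_eq_zero_iff.1 hp))

lemma map_commute_of_eq_shift [Finite ι] (h : IsCoord f s μ φ) (hg : Commute f g)
    (hv : φ v ∈ primary μ z) (hw : φ w = shift p (φ v)) : φ (g w) = shift p (φ (g v)) := by
  have hpow : Commute ((f - z • 1) ^ p) g :=
    (hg.sub_left ((Commute.one_left g).smul_left z)).pow_left p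
  obtain rfl : w = ((f - z • 1) ^ p) v := h.injective (hw.trans (h.map_sub_pow hv p).symm)
  rw [← Module.End.mul_apply, ← hpow.eq, Module.End.mul_apply,
    h.map_sub_pow (h.map_commute_mem_primary hg hv)]

lemma map_commute_of_eq_unit [Finite ι] (h : IsCoord f s μ φ) (hg : Commute f g) (ha : a < s j)
    (hv : φ v = unit j a) :
    φ (g v) ∈ supported fun i b => μ i = μ j ∧ b ≤ a ∧ b + s j ≤ a + s i := by
  refine mem_supported.2 fun i b hb => ?_
  have hlow : φ (g v) ∈ supported fun i b => μ i = μ j ∧ b < a + 1 :=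
    h.map_commute_mem_supported hg (hv ▸ unit_mem_supported ⟨rfl, a.lt_succ_self⟩)
  obtain ⟨hi, hba⟩ := mem_supported.1 hlow i b hb
  obtain ⟨t, ht⟩ := h.exists_eq (unit_mem_supported (j := j) (a := s j - 1) (by omega))
  have hshift : φ (g v) = shift (s j - 1 - a) (φ (g t)) := by
    refine h.map_commute_of_eq_shift hg (z := μ j) (ht ▸ unit_mem_supported rfl) ?_
    rw [hv, ht, shift_unit (by omega), Nat.sub_sub_self (by omega)]
  rw [hshift] at hb
  have : b + (s j - 1 - a) < s i := mem_supported.1 (h.mem_bounded (g t)) i _ hb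
  exact ⟨hi, by omega, by omega⟩

end Commute

section Chain

variable [LinearOrder ι]

lemma hasLead_zero_iff (h : IsCoord f s μ φ) :
    HasLead μ j 0 (φ w) ↔
      (f - μ j • 1) w = 0 ∧ (∃ a, φ w j a ≠ 0) ∧ ∀ i, j < i → ∀ a, φ w i a = 0 := by
  have hker := h.pow_eq_zero_iff (z := μ j) (p := 1) (v := w)
  rw [pow_one] at hker
  rw [hker]
  constructor
  · intro hl
    refine ⟨mem_supported.2 fun i b hb => ⟨mem_supported.1 hl.mem_primary i b hb, hl.lt_succ hb⟩,
      ⟨0, hl.ne_zero⟩, fun i hi a => by_contra fun ha => ?_⟩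
    rcases hl.lt_or_eq ha with ha | ha
    · omega
    · exact hi.not_ge ha.2
  · rintro ⟨hsupp, ⟨a, ha⟩, hr⟩
    rw [mem_supported] at hsupp
    refine ⟨?_, mem_supported.2 fun i b hb => ⟨(hsupp i b hb).1, Prod.Lex.toLex_le_toLex.2 <|
      Or.inr ⟨?_, le_of_not_gt fun hi => hb (hr i hi b)⟩⟩⟩
    · rwa [Nat.lt_one_iff.1 (hsupp j a ha).2] at ha
    · exact Nat.lt_one_iff.1 (hsupp i b hb).2

lemma hasLead_sub_pow_iff (h : IsCoord f s μ φ) :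
    HasLead μ j 0 (φ (((f - μ j • 1) ^ p) v)) ↔ HasLead μ j p (φ v) := by
  constructor
  · intro hl
    have h0 := (h.hasLead_zero_iff.1 hl).1
    rw [← Module.End.mul_apply, ← pow_succ', h.pow_eq_zero_iff] at h0
    rw [h.map_sub_pow (supported_mono (fun _ _ => And.left) h0)] at hl
    simpa only [zero_add] using hl.of_shift (by simpa only [zero_add] using h0)
  · intro hl
    rw [h.map_sub_pow hl.mem_primary]
    exact HasLead.shift (by rwa [zero_add])

end Chain

end IsCoord

end Coord

section ChangeOfCoordinates

variable {K ι E : Type*} [Field K] [AddCommGroup E] [Module K E]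
  {f : Module.End K E} {s k : ι → ℕ} {μ : ι → K} {φ ψ : E →ₗ[K] BlockSeq K ι}
  {N : Submodule K (BlockSeq K ι)} {i j : ι} {a : ℕ} {v : E}

section Combine

variable [Fintype ι] {t : ι → BlockSeq K ι}

/-- The linear map that takes the chain of units of block `i`, up to its last unit at position
`s i - 1`, to the chain of shifts of `t i`. -/
def combine (s : ι → ℕ) (t : ι → BlockSeq K ι) : Module.End K (BlockSeq K ι) where
  toFun v := ∑ i, ∑ a ∈ Finset.range (s i), v i a • shift (s i - 1 - a) (t i)
  map_add' v w := by simp only [Pi.add_apply, add_smul, Finset.sum_add_distrib]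
  map_smul' c v := by
    simp only [Pi.smul_apply, smul_eq_mul, mul_smul, Finset.smul_sum, RingHom.id_apply]

lemma combine_unit (ha : a < s j) : combine s t (unit j a) = shift (s j - 1 - a) (t j) := by
  classical
  simp only [combine, LinearMap.coe_mk, AddHom.coe_mk]
  rw [Finset.sum_eq_single j (fun i _ hi => ?_) (by simp),
    Finset.sum_eq_single a (fun b _ hb => ?_) (by simp [ha]), unit_self, one_smul]
  · simp [unit, hb]
  · simp [unit, hi]

lemma combine_mem {W : Submodule K (BlockSeq K ι)} {w : BlockSeq K ι} (hw : w ∈ bounded k)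
    (hk : k ≤ s) (ht : ∀ j a, a < k j → shift (s j - 1 - a) (t j) ∈ W) : combine s t w ∈ W := by
  refine Submodule.mem_comap.1 (mem_of_unit_mem hw fun i a ha => ?_)
  have hak := mem_supported.1 hw i a ha
  rw [Submodule.mem_comap, combine_unit (hak.trans_le (hk i))]
  exact ht i a hak

end Combine

lemma IsCoord.jordan_mem_map_comap_bounded (hφ : IsCoord f s μ φ) (hψ : IsCoord f s μ ψ)
    {y : BlockSeq K ι} (hy : y ∈ ((bounded k).comap φ).map ψ) :
    jordan μ y ∈ ((bounded k).comap φ).map ψ := by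
  obtain ⟨v, hv, rfl⟩ := hy
  refine ⟨f v, ?_, hψ.map_apply v⟩
  rw [SetLike.mem_coe, Submodule.mem_comap, hφ.map_apply]
  exact jordan_mem_bounded hv

variable [LinearOrder ι]

/-- Some chain that is as long as block `j` leads to the eigenvector of block `j` and contains a
chain of length `k j` in `N`. -/
def HasFullChain (μ : ι → K) (s k : ι → ℕ) (N : Submodule K (BlockSeq K ι)) (j : ι) : Prop :=
  ∃ t ∈ bounded s, HasLead μ j (s j - 1) t ∧ shift (s j - k j) t ∈ N

lemma hasFullChain_of_lt (hkj : k j ≤ s j) (hs : 0 < s j)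
    (h : 0 < k j → ∃ y ∈ N, HasLead μ j (k j - 1) y ∧ ∀ i a, y i a ≠ 0 → a + s j < s i + k j) :
    HasFullChain μ s k N j := by
  rcases (k j).eq_zero_or_pos with h0 | h0
  · refine ⟨unit j (s j - 1), unit_mem_supported (by omega), hasLead_unit μ j _, ?_⟩
    have hker : shift (s j - k j) (unit j (s j - 1) : BlockSeq K ι) ∈ supported fun _ _ => False :=
      shift_mem_supported (P := fun i a => i = j ∧ a < s j) (fun i a h => by omega)
        (unit_mem_supported ⟨rfl, by omega⟩)
    convert N.zero_mem
    exact funext₂ fun i a => hker i a not_false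
  · obtain ⟨y, hy, hl, hlt⟩ := h h0
    refine ⟨unshift (s j - k j) y, ?_, ?_, by rwa [shift_unshift]⟩
    · exact unshift_mem_supported.2 <| mem_supported.2 fun i a ha => by
        have := hlt i a ha
        omega
    · rw [show s j - 1 = k j - 1 + (s j - k j) by omega]
      refine HasLead.of_shift (by rwa [shift_unshift]) <|
        unshift_mem_supported.2 <| mem_supported.2 fun i a ha => ⟨?_, ?_⟩
      · exact mem_supported.1 hl.mem_primary i a ha
      · have := hl.lt_succ ha
        omega

lemma HasProfile.hasFullChain (hN : HasProfile μ N k) (hkj : k j ≤ s j) (hs : 0 < s j)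
    (hsize : ∀ i, μ i = μ j → s j ≤ s i ∨ s j ≤ s i + 1 ∧ j < i) : HasFullChain μ s k N j := by
  refine hasFullChain_of_lt hkj hs fun h0 => ?_
  obtain ⟨y, hy, hl⟩ := (hN j (k j - 1)).2 (by omega)
  refine ⟨y, hy, hl, fun i a ha => ?_⟩
  rcases hsize i (mem_supported.1 hl.mem_primary i a ha) with h | ⟨h, hji⟩
  · have := hl.lt_succ ha
    omega
  · rcases hl.lt_or_eq ha with h' | ⟨-, h'⟩
    · omega
    · exact absurd hji h'.not_gt

lemma HasFullChain.congr {s' : ι → ℕ} (h : HasFullChain μ s k N j)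
    (hs : ∀ i, μ i = μ j → s i = s' i) : HasFullChain μ s' k N j := by
  obtain ⟨t, ht, hl, hN⟩ := h
  refine ⟨t, mem_supported.2 fun i a ha => ?_, ?_, ?_⟩
  · rw [← hs i (mem_supported.1 hl.mem_primary i a ha)]
    exact mem_supported.1 ht i a ha
  all_goals rwa [← hs j rfl]

namespace IsCoord

lemma hasLead_map_unit (hφ : IsCoord f s μ φ) (hψ : IsCoord f s μ ψ)
    (h0 : ∀ j v, φ v = unit j 0 → HasLead μ j 0 (ψ v)) (hv : φ v = unit j a) :
    HasLead μ j a (ψ v) := by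
  have hzero := hφ.pow_eq_zero_iff.2 <|
    hv ▸ unit_mem_supported (P := fun i b => μ i = μ j ∧ b < a + 1) ⟨rfl, a.lt_succ_self⟩
  have hsupp := hψ.pow_eq_zero_iff.1 hzero
  have hbase := h0 j (((f - μ j • 1) ^ a) v) <| by
    rw [hφ.map_sub_pow (hv ▸ unit_mem_supported rfl), hv, shift_unit le_rfl, Nat.sub_self]
  rw [hψ.map_sub_pow (supported_mono (fun _ _ => And.left) hsupp)] at hbase
  simpa only [zero_add] using hbase.of_shift (by simpa only [zero_add] using hsupp)

lemma hasLead_map [Finite ι] (hφ : IsCoord f s μ φ) {L : E →ₗ[K] BlockSeq K ι}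
    (hL : ∀ j a v, φ v = unit j a → HasLead μ j a (L v)) (h : HasLead μ j a (φ v)) :
    HasLead μ j a (L v) := by
  have ha : a < s j := mem_supported.1 (hφ.mem_bounded v) j a h.ne_zero
  obtain ⟨e, he⟩ := hφ.exists_eq (unit_mem_supported (j := j) (a := a) ha)
  have hlower := h.sub_smul_mem (hasLead_unit μ j a)
  rw [unit_self, div_one, ← he, ← map_smul, ← map_sub] at hlower
  set c := φ v j a
  have hmap : L (v - c • e) ∈ supported fun i b => μ i = μ j ∧ toLex (b, i) < toLex (a, j) := by
    suffices hmem : φ (v - c • e) ∈ Submodule.map φ ((supported fun i b =>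
        μ i = μ j ∧ toLex (b, i) < toLex (a, j)).comap L) by
      obtain ⟨w, hw, hwv⟩ := hmem
      rwa [← hφ.injective hwv]
    refine mem_of_unit_mem (hφ.mem_bounded _) fun i b hb => ?_
    obtain ⟨hi, hlt⟩ := mem_supported.1 hlower i b hb
    obtain ⟨w, hw⟩ := hφ.exists_eq
      (unit_mem_supported (mem_supported.1 (hφ.mem_bounded _) i b hb))
    exact ⟨w, supported_mono (fun _ _ h => ⟨h.1.trans hi, h.2.trans_lt hlt⟩)
      (hL i b w hw).mem_supported, hw⟩
  refine ((hL j a e he).smul h.ne_zero).of_sub_mem ?_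
  rw [← neg_mem_iff, neg_sub]
  rwa [map_sub, map_smul] at hmap

lemma hasLead_map_iff [Finite ι] (hφ : IsCoord f s μ φ) (hψ : IsCoord f s μ ψ)
    (h0 : ∀ j v, φ v = unit j 0 → HasLead μ j 0 (ψ v)) :
    HasLead μ j a (ψ v) ↔ HasLead μ j a (φ v) := by
  have hmap {j a} : HasLead μ j a (φ v) → HasLead μ j a (ψ v) :=
    hφ.hasLead_map fun _ _ _ hv => hφ.hasLead_map_unit hψ h0 hv
  refine ⟨fun h => ?_, hmap⟩
  have hz : φ v ∈ primary μ (μ j) :=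
    hφ.mem_maxGenEigenspace_iff.1 (hψ.mem_maxGenEigenspace_iff.2 h.mem_primary)
  have hv : φ v ≠ 0 := fun h' => h.ne_zero <| by
    rw [(map_eq_zero_iff φ hφ.injective).1 h', map_zero]
    rfl
  obtain ⟨i, b, -, hl⟩ := exists_hasLead (hφ.mem_bounded v) hz hv
  obtain ⟨rfl, rfl⟩ := (hmap hl).unique h
  exact hl

lemma hasProfile_map_comap_bounded [Finite ι] (hφ : IsCoord f s μ φ) (hψ : IsCoord f s μ ψ)
    (h0 : ∀ j v, φ v = unit j 0 → HasLead μ j 0 (ψ v)) (hk : k ≤ s) :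
    HasProfile μ (((bounded k).comap φ).map ψ) k := by
  refine fun j a => ⟨?_, fun ha => ?_⟩
  · rintro ⟨_, ⟨v, hv, rfl⟩, hl⟩
    exact mem_supported.1 hv j a ((hφ.hasLead_map_iff hψ h0).1 hl).ne_zero
  · obtain ⟨v, hv⟩ := hφ.exists_eq (unit_mem_supported (j := j) (a := a) (ha.trans_le (hk j)))
    refine ⟨ψ v, ⟨v, ?_, rfl⟩, hφ.hasLead_map_unit hψ h0 hv⟩
    rw [SetLike.mem_coe, Submodule.mem_comap, hv]
    exact unit_mem_supported ha

lemma hasFullChain_map_comap_bounded (hφ : IsCoord f s μ φ) (hψ : IsCoord f s μ ψ)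
    (h0 : ∀ j v, φ v = unit j 0 → HasLead μ j 0 (ψ v)) (hs : 0 < s j) :
    HasFullChain μ s k (((bounded k).comap φ).map ψ) j := by
  obtain ⟨v, hv⟩ := hφ.exists_eq (unit_mem_supported (j := j) (a := s j - 1) (by omega))
  have hl := hφ.hasLead_map_unit hψ h0 hv
  refine ⟨ψ v, hψ.mem_bounded v, hl, ((f - μ j • 1) ^ (s j - k j)) v, ?_,
    hψ.map_sub_pow hl.mem_primary _⟩
  rw [SetLike.mem_coe, Submodule.mem_comap, hφ.map_sub_pow (hv ▸ unit_mem_supported rfl), hv]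
  refine shift_mem_supported (P := fun i a => i = j ∧ a < s j) ?_
    (unit_mem_supported ⟨rfl, by omega⟩)
  rintro i a ⟨rfl, ha⟩
  omega

end IsCoord

lemma combine_jordan [Fintype ι] {t : ι → BlockSeq K ι}
    (ht : ∀ j, HasLead μ j (s j - 1) (t j)) (hs : ∀ j, 0 < s j) {w : BlockSeq K ι}
    (hw : w ∈ bounded s) :
    combine s t (jordan μ w) = jordan μ (combine s t w) := by
  refine mem_of_unit_mem
    (W := LinearMap.eqLocus (combine s t ∘ₗ jordan μ) (jordan μ ∘ₗ combine s t)) hw fun j a ha => ?_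
  replace ha : a < s j := mem_supported.1 hw j a ha
  rw [LinearMap.mem_eqLocus, LinearMap.comp_apply, LinearMap.comp_apply,
    jordan_of_mem_primary (z := μ j) (unit_mem_supported rfl), map_add, map_smul, combine_unit ha,
    jordan_of_mem_primary (shift_mem_primary _ (ht j).mem_primary), add_right_inj, shift_shift]
  rcases a with _ | a
  · have hunit : shift 1 (unit j 0 : BlockSeq K ι) = 0 :=
      funext₂ fun i a => unit_mem_supported (P := fun _ a => a = 0) rfl i (a + 1) (by simp)
    rw [hunit, map_zero, eq_comm]
    refine funext₂ fun i a => by_contra fun h => ?_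
    have := (ht j).lt_succ h
    have := hs j
    omega
  · rw [shift_unit (by omega), Nat.add_sub_cancel, combine_unit (by omega)]
    congr 2
    omega

namespace IsCoord

variable [FiniteDimensional K E]

/-- An endomorphism intertwined with the Jordan operator has Jordan coordinates as soon as the
image contains vectors with all possible leads: surjectivity follows by elimination, injectivity by
counting dimensions. -/
lemma of_hasLead [Finite ι] (hφ : IsCoord f s μ φ) (hmap : ∀ v, ψ (f v) = jordan μ (ψ v))
    (hs : ∀ v, ψ v ∈ bounded s) (hlead : ∀ j a, a < s j → ∃ v, HasLead μ j a (ψ v)) :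
    IsCoord f s μ ψ := by
  have hle : LinearMap.range ψ ≤ bounded s := by
    rintro _ ⟨v, rfl⟩
    exact hs v
  have hprof : HasProfile μ (LinearMap.range ψ) s := fun j a =>
    ⟨fun ⟨_, hy, hl⟩ => mem_supported.1 (hle hy) j a hl.ne_zero,
      fun ha => let ⟨v, hv⟩ := hlead j a ha; ⟨ψ v, ⟨v, rfl⟩, hv⟩⟩
  have hrange : LinearMap.range ψ = bounded s :=
    hprof.eq_of_le (hasProfile_bounded μ s) hle le_rfl (isGraded_supported μ _)
  refine ⟨LinearMap.ker_eq_bot.1 (Submodule.finrank_eq_zero.1 ?_), hrange, hmap⟩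
  have hψ := LinearMap.finrank_range_add_finrank_ker ψ
  have hφ' := LinearMap.finrank_range_of_inj hφ.injective
  rw [hrange, ← hφ.range_eq] at hψ
  omega

variable [Finite ι]

/-- The full chains are the chains of the last basis vectors in the new coordinates. -/
theorem exists_isCoord_iff (hφ : IsCoord f s μ φ) (hs : ∀ j, 0 < s j) (hk : k ≤ s) :
    (∃ ψ, IsCoord f s μ ψ ∧ (∀ j v, φ v = unit j 0 → HasLead μ j 0 (ψ v)) ∧
      N = ((bounded k).comap φ).map ψ) ↔
    (∀ y ∈ N, jordan μ y ∈ N) ∧ N ≤ bounded s ∧ HasProfile μ N k ∧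
      ∀ j, HasFullChain μ s k N j := by
  cases nonempty_fintype ι
  constructor
  · rintro ⟨ψ, hψ, h0, rfl⟩
    exact ⟨fun y => hφ.jordan_mem_map_comap_bounded hψ, hψ.map_le _,
      hφ.hasProfile_map_comap_bounded hψ h0 hk,
      fun j => hφ.hasFullChain_map_comap_bounded hψ h0 (hs j)⟩
  · rintro ⟨hN, hNs, hprof, hchain⟩
    choose t hts htl htN using hchain
    have hunit (j v a) (ha : a < s j) (hv : φ v = unit j a) :
        HasLead μ j a ((combine s t ∘ₗ φ) v) := by
      rw [LinearMap.comp_apply, hv, combine_unit ha]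
      exact HasLead.shift (by rw [Nat.add_sub_of_le (by omega)]; exact htl j)
    have hψ : IsCoord f s μ (combine s t ∘ₗ φ) := by
      refine hφ.of_hasLead (fun v => ?_) (fun v => ?_) fun j a ha => ?_
      · rw [LinearMap.comp_apply, hφ.map_apply, combine_jordan htl hs (hφ.mem_bounded v),
          LinearMap.comp_apply]
      · exact combine_mem (hφ.mem_bounded v) le_rfl fun j a _ => shift_mem_bounded _ (hts j)
      · obtain ⟨v, hv⟩ := hφ.exists_eq (unit_mem_supported (j := j) (a := a) ha)
        exact ⟨v, hunit j v a ha hv⟩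
    have h0 (j v) (hv : φ v = unit j 0) := hunit j v 0 (hs j) hv
    have hle : ((bounded k).comap φ).map (combine s t ∘ₗ φ) ≤ N := by
      rintro _ ⟨v, hv, rfl⟩
      refine combine_mem hv hk fun j a ha => ?_
      replace ha : a < k j := ha
      have hkj : k j ≤ s j := hk j
      rw [show s j - 1 - a = k j - 1 - a + (s j - k j) by omega, ← shift_shift]
      exact shift_mem hN (htN j) (shift_mem_primary _ (htl j).mem_primary) _
    have hgr : IsGraded μ N := by
      rw [← hφ.map_comap hNs] at hN ⊢
      exact hφ.isGraded_map (hφ.mem_invtSubmodule_iff.2 hN)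
    exact ⟨_, hψ, h0,
      ((hφ.hasProfile_map_comap_bounded hψ h0 hk).eq_of_le hprof hle hNs hgr).symm⟩

end IsCoord

end ChangeOfCoordinates

lemma IsCoord.finrank_comap {K ι E : Type*} [Field K] [AddCommGroup E] [Module K E]
    {f : Module.End K E} {s : ι → ℕ} {μ : ι → K} {φ : E →ₗ[K] BlockSeq K ι}
    (hφ : IsCoord f s μ φ) (M : Submodule K (BlockSeq K ι)) :
    Module.finrank K (M.comap φ) = Module.finrank K ↥(bounded s ⊓ M) := by
  rw [← hφ.range_eq, ← Submodule.map_comap_eq]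
  exact (Submodule.equivMapOfInjective φ hφ.injective _).finrank_eq

/-- The initial spaces of eigenvectors have the same dimension in both coordinate systems, so the
diagonal entries of a triangular change of coordinates cannot vanish. -/
lemma IsCoord.hasLead_zero_of_mem_supported {K ι E : Type*} [Field K] [AddCommGroup E] [Module K E]
    [FiniteDimensional K E] [LinearOrder ι] [Finite ι] {f : Module.End K E} {s : ι → ℕ} {μ : ι → K}
    {φ ψ : E →ₗ[K] BlockSeq K ι} (hφ : IsCoord f s μ φ) (hψ : IsCoord f s μ ψ)
    (h : ∀ j v, φ v = unit j 0 → ψ v ∈ supported fun i _ => i ≤ j) {j : ι} {v : E}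
    (hv : φ v = unit j 0) : HasLead μ j 0 (ψ v) := by
  have heig {j v} (hv : φ v = unit j 0) : ψ v ∈ supported fun i a => μ i = μ j ∧ a < 1 :=
    hψ.pow_eq_zero_iff.1 (hφ.pow_eq_zero_iff.2 (hv ▸ unit_mem_supported ⟨rfl, one_pos⟩))
  refine ⟨fun h0 => ?_, mem_supported.2 fun i a ha => ?_⟩
  · set U : Submodule K (BlockSeq K ι) := supported fun i a => i < j ∧ a < 1
    have hle : U.comap φ ≤ U.comap ψ := by
      intro w hw
      suffices hmem : φ w ∈ (U.comap ψ).map φ by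
        obtain ⟨x, hx, hxw⟩ := hmem
        rwa [← hφ.injective hxw]
      refine mem_of_unit_mem (hφ.mem_bounded w) fun i a ha => ?_
      obtain ⟨hij, ha1⟩ := mem_supported.1 hw i a ha
      obtain rfl : a = 0 := Nat.lt_one_iff.1 ha1
      obtain ⟨x, hx⟩ := hφ.exists_eq
        (unit_mem_supported (mem_supported.1 (hφ.mem_bounded w) i 0 ha))
      exact ⟨x, mem_supported.2 fun l b hb => ⟨(mem_supported.1 (h i x hx) l b hb).trans_lt hij,
        (mem_supported.1 (heig hx) l b hb).2⟩, hx⟩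
    have heq := Submodule.eq_of_le_of_finrank_eq hle (by rw [hφ.finrank_comap, hψ.finrank_comap])
    have hvU : v ∈ U.comap ψ := mem_supported.2 fun i a ha => by
      have ha1 := (mem_supported.1 (heig hv) i a ha).2
      obtain rfl : a = 0 := Nat.lt_one_iff.1 ha1
      exact ⟨(mem_supported.1 (h j v hv) i 0 ha).lt_of_ne fun hij => ha (hij ▸ h0), ha1⟩
    rw [← heq, Submodule.mem_comap, hv] at hvU
    exact lt_irrefl j (of_unit_mem_supported hvU).1
  · obtain ⟨hi, ha1⟩ := mem_supported.1 (heig hv) i a ha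
    exact ⟨hi, Prod.Lex.toLex_le_toLex.2 (Or.inr
      ⟨Nat.lt_one_iff.1 ha1, mem_supported.1 (h j v hv) i a ha⟩)⟩

section Matrix

variable {u : ℕ} {s k l : Fin u → ℕ} {μ : Fin u → ℂ} {i j : Fin u} {a : ℕ}

/-- The extension of a coordinate vector by zero. -/
def ext (s : Fin u → ℕ) : (BlockIdx s → ℂ) →ₗ[ℂ] BlockSeq ℂ (Fin u) where
  toFun x i a := if h : a < s i then x ⟨i, a, h⟩ else 0
  map_add' x y := by ext i a; by_cases h : a < s i <;> simp [h]
  map_smul' c x := by ext i a; by_cases h : a < s i <;> simp [h]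

lemma ext_apply_of_lt (x : BlockIdx s → ℂ) (h : a < s i) : ext s x i a = x ⟨i, a, h⟩ := dif_pos h

lemma ext_mem_bounded (s : Fin u → ℕ) (x : BlockIdx s → ℂ) : ext s x ∈ bounded s :=
  fun _ _ h => dif_neg h

lemma exists_ext_eq {y : BlockSeq ℂ (Fin u)} (hy : y ∈ bounded s) : ∃ x, ext s x = y := by
  refine ⟨fun p => y p.1 p.2, funext₂ fun i a => ?_⟩
  by_cases h : a < s i
  · exact ext_apply_of_lt _ h
  · rw [ext_mem_bounded s _ i a h, hy i a h]

lemma ext_single (h : a < s j) :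
    ext s (Pi.single (⟨j, a, h⟩ : BlockIdx s) 1) = unit j a := by
  refine funext₂ fun i b => ?_
  by_cases hp : i = j ∧ b = a
  · obtain ⟨rfl, rfl⟩ := hp
    rw [ext_apply_of_lt _ h, Pi.single_eq_same, unit_self]
  · rw [unit_mem_supported (P := fun i b => i = j ∧ b = a) ⟨rfl, rfl⟩ i b hp]
    by_cases hb : b < s i
    · rw [ext_apply_of_lt _ hb, Pi.single_eq_of_ne]
      rintro ⟨⟩
      exact hp ⟨rfl, rfl⟩
    · exact ext_mem_bounded s _ i b hb

lemma sum_ite_mul_eq_ext (x : BlockIdx s → ℂ) (i : Fin u) (c : ℕ) :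
    ∑ b : Fin (s i), (if (b : ℕ) = c then 1 else 0) * x ⟨i, b⟩ = ext s x i c := by
  by_cases h : c < s i
  · rw [ext_apply_of_lt x h, Finset.sum_eq_single ⟨c, h⟩ (fun b _ hb => ?_) (by simp)]
    · simp
    · rw [if_neg fun h' => hb (Fin.ext h'), zero_mul]
  · rw [ext_mem_bounded s x i c h]
    exact Finset.sum_eq_zero fun b _ => by rw [if_neg (by omega), zero_mul]

lemma blockDiagonal'_mulVec (M : ∀ i, Matrix (Fin (s i)) (Fin (s i)) ℂ) (x : BlockIdx s → ℂ)
    (i : Fin u) (a : Fin (s i)) :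
    (blockDiagonal' M *ᵥ x) ⟨i, a⟩ = ∑ b, M i a b * x ⟨i, b⟩ := by
  simp only [mulVec, dotProduct, Fintype.sum_sigma]
  rw [Finset.sum_eq_single i (fun j _ hj => ?_) (by simp)]
  · simp only [blockDiagonal'_apply_eq]
  · exact Finset.sum_eq_zero fun b _ => by rw [blockDiagonal'_apply_ne _ _ _ hj.symm, zero_mul]

lemma backwardShift_pow_apply (m k : ℕ) (a b : Fin m) :
    (backwardShift m ^ k) a b = if (b : ℕ) = a + k then 1 else 0 := by
  induction k generalizing b with
  | zero => simp [Matrix.one_apply, Fin.ext_iff, eq_comm]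
  | succ k ih =>
    simp only [pow_succ, Matrix.mul_apply, ih, ite_mul, one_mul, zero_mul]
    by_cases h : (a : ℕ) + k < m
    · rw [Finset.sum_eq_single ⟨a + k, h⟩ (fun c _ hc => if_neg fun h' => hc (Fin.ext h'))
        (by simp)]
      simp [backwardShift, add_assoc]
    · rw [Finset.sum_eq_zero fun c _ => if_neg (by omega), if_neg (by omega)]

lemma shiftMatrix_mulVec (s k : Fin u → ℕ) (x : BlockIdx s → ℂ) (i : Fin u) (a : Fin (s i)) :
    (shiftMatrix s k *ᵥ x) ⟨i, a⟩ = ext s x i (a + k i) := by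
  rw [shiftMatrix, blockDiagonal'_mulVec]
  simp only [backwardShift_pow_apply, sum_ite_mul_eq_ext]

lemma jordanMatrix_mulVec (s : Fin u → ℕ) (μ : Fin u → ℂ) (x : BlockIdx s → ℂ) (i : Fin u)
    (a : Fin (s i)) :
    (jordanMatrix s μ *ᵥ x) ⟨i, a⟩ = μ i * x ⟨i, a⟩ + ext s x i (a + 1) := by
  rw [jordanMatrix, blockDiagonal'_mulVec]
  simp only [Matrix.add_apply, add_mul, Finset.sum_add_distrib, backwardShift, Matrix.of_apply,
    sum_ite_mul_eq_ext]
  simp [Matrix.one_apply]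

lemma isCoord_ext (s : Fin u → ℕ) (μ : Fin u → ℂ) :
    IsCoord (toLin' (jordanMatrix s μ)) s μ (ext s) where
  injective x y h := by
    funext ⟨i, a⟩
    rw [← ext_apply_of_lt x a.2, ← ext_apply_of_lt y a.2, h]
  range_eq := by
    ext y
    exact ⟨by rintro ⟨x, rfl⟩; exact ext_mem_bounded s x, exists_ext_eq⟩
  map_apply x := by
    refine funext₂ fun i a => ?_
    by_cases h : a < s i
    · rw [toLin'_apply, ext_apply_of_lt _ h, jordanMatrix_mulVec, jordan_apply,
        ext_apply_of_lt x h]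
    · rw [ext_mem_bounded s _ i a h, jordan_mem_bounded (ext_mem_bounded s x) i a h]

lemma ker_shiftMatrix (s k : Fin u → ℕ) :
    LinearMap.ker (shiftMatrix s k).mulVecLin = (bounded k).comap (ext s) := by
  ext x
  rw [LinearMap.mem_ker, mulVecLin_apply, Submodule.mem_comap, mem_supported]
  constructor
  · refine fun h i a ha => lt_of_not_ge fun hka => ha ?_
    have has : a < s i := mem_supported.1 (ext_mem_bounded s x) i a ha
    have := congrFun h ⟨i, a - k i, by omega⟩
    rwa [shiftMatrix_mulVec, Nat.sub_add_cancel hka] at this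
  · refine fun h => funext fun p => by_contra fun hp => ?_
    rw [shiftMatrix_mulVec] at hp
    exact Nat.not_lt.2 (Nat.le_add_left _ _) (h _ _ hp)

lemma ker_shiftMatrix_le_iff (hk : k ≤ s) :
    LinearMap.ker (shiftMatrix s k).mulVecLin ≤ LinearMap.ker (shiftMatrix s l).mulVecLin ↔
      k ≤ l := by
  rw [ker_shiftMatrix, ker_shiftMatrix]
  refine ⟨fun h i => le_of_forall_lt fun a ha => ?_, fun h => Submodule.comap_mono (bounded_mono h)⟩
  have hl : Pi.single (⟨i, a, ha.trans_le (hk i)⟩ : BlockIdx s) 1 ∈ (bounded l).comap (ext s) :=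
    h (by rw [Submodule.mem_comap, ext_single]; exact unit_mem_supported ha)
  rw [Submodule.mem_comap, ext_single] at hl
  exact of_unit_mem_supported (P := fun i a => a < l i) hl

lemma shiftMatrix_injOn (s : Fin u → ℕ) : Set.InjOn (shiftMatrix s) (Set.Iic s) :=
  fun _ hk _ hl h => le_antisymm
    ((ker_shiftMatrix_le_iff hk).1 (by rw [h])) ((ker_shiftMatrix_le_iff hl).1 (by rw [h]))

lemma isCoord_ext_comp_iff {T : Matrix (BlockIdx s) (BlockIdx s) ℂ} :
    IsCoord (toLin' (jordanMatrix s μ)) s μ (ext s ∘ₗ T.mulVecLin) ↔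
      IsUnit T ∧ Commute T (jordanMatrix s μ) := by
  have hcoord := isCoord_ext s μ
  constructor
  · intro h
    refine ⟨mulVec_injective_iff_isUnit.1 (h.injective.of_comp (f := ext s)),
      toLin'.injective (LinearMap.ext fun x => hcoord.injective ?_)⟩
    rw [toLin'_mul, toLin'_mul, LinearMap.comp_apply, LinearMap.comp_apply, hcoord.map_apply]
    exact h.map_apply x
  · rintro ⟨hT, hcomm⟩
    refine ⟨hcoord.injective.comp (mulVec_injective_of_isUnit hT), ?_, fun x => ?_⟩
    · rw [LinearMap.range_comp_of_range_eq_top _ (LinearMap.range_eq_top.2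
        (mulVec_surjective_iff_isUnit.2 hT)), hcoord.range_eq]
    · rw [LinearMap.comp_apply, mulVecLin_apply, toLin'_apply, mulVec_mulVec, hcomm.eq,
        ← mulVec_mulVec]
      exact hcoord.map_apply _

lemma exists_ext_comp_eq {ψ : (BlockIdx s → ℂ) →ₗ[ℂ] BlockSeq ℂ (Fin u)}
    (hψ : ∀ x, ψ x ∈ bounded s) :
    ∃ T : Matrix (BlockIdx s) (BlockIdx s) ℂ, ext s ∘ₗ T.mulVecLin = ψ := by
  choose col hcol using fun p : BlockIdx s => exists_ext_eq (hψ (Pi.single p 1))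
  refine ⟨Matrix.of fun p q => col q p, LinearMap.pi_ext' fun p => LinearMap.ext_ring ?_⟩
  simp only [LinearMap.comp_apply, LinearMap.coe_single, mulVecLin_apply, mulVec_single_one]
  exact hcol p

lemma hasLead_ext_mulVec_iff {T : Matrix (BlockIdx s) (BlockIdx s) ℂ} (hs : ∀ j, 0 < s j)
    (hT : IsCoord (toLin' (jordanMatrix s μ)) s μ (ext s ∘ₗ T.mulVecLin)) :
    (∀ j x, ext s x = unit j 0 → HasLead μ j 0 ((ext s ∘ₗ T.mulVecLin) x)) ↔
      ∀ (i j : Fin u) (hi : 0 < s i) (hj : 0 < s j), j < i → T ⟨i, 0, hi⟩ ⟨j, 0, hj⟩ = 0 := by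
  have hcoord := isCoord_ext s μ
  have hcol (j x) (hx : ext s x = unit j 0) :
      (ext s ∘ₗ T.mulVecLin) x = ext s (T.col ⟨j, 0, hs j⟩) := by
    obtain rfl : x = Pi.single ⟨j, 0, hs j⟩ 1 := hcoord.injective (hx.trans (ext_single _).symm)
    rw [LinearMap.comp_apply, mulVecLin_apply, mulVec_single_one]
  constructor
  · intro h i j hi hj hji
    have hunit : ext s (Pi.single ⟨j, 0, hs j⟩ 1) = unit j 0 := ext_single _
    have hl := h j _ hunit
    rw [hcol j _ hunit] at hl
    by_contra hne
    have := hl.lt_or_eq (i := i) (b := 0) (by rwa [ext_apply_of_lt _ hi])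
    exact hji.not_ge (this.resolve_left (lt_irrefl 0)).2
  · refine fun h j x hx => hcoord.hasLead_zero_of_mem_supported hT (fun j x hx => ?_) hx
    have heig : (ext s ∘ₗ T.mulVecLin) x ∈ supported fun i a => μ i = μ j ∧ a < 1 :=
      hT.pow_eq_zero_iff.1 (hcoord.pow_eq_zero_iff.2 (hx ▸ unit_mem_supported ⟨rfl, one_pos⟩))
    refine mem_supported.2 fun i a ha => le_of_not_gt fun hji => ha ?_
    obtain rfl : a = 0 := Nat.lt_one_iff.1 (mem_supported.1 heig i a ha).2
    rw [hcol j x hx, ext_apply_of_lt _ (hs i)]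
    exact h i j (hs i) (hs j) hji

lemma ker_mul_inv {m : Type*} [Fintype m] [DecidableEq m] (Z : Matrix m m ℂ) {T : Matrix m m ℂ}
    (hT : IsUnit T) :
    LinearMap.ker (Z * T⁻¹).mulVecLin = (LinearMap.ker Z.mulVecLin).map T.mulVecLin := by
  have hdet := T.isUnit_iff_isUnit_det.1 hT
  ext x
  simp only [LinearMap.mem_ker, Submodule.mem_map, mulVecLin_apply, ← mulVec_mulVec]
  constructor
  · exact fun h => ⟨T⁻¹ *ᵥ x, h, by rw [mulVec_mulVec, T.mul_nonsing_inv hdet, one_mulVec]⟩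
  · rintro ⟨y, hy, rfl⟩
    rwa [mulVec_mulVec _ T⁻¹, T.nonsing_inv_mul hdet, one_mulVec]

theorem exists_ker_shiftMatrix_mul_inv_iff (hs : ∀ j, 0 < s j) (hk : k ≤ s)
    {N : Submodule ℂ (BlockIdx s → ℂ)} :
    (∃ T : Matrix (BlockIdx s) (BlockIdx s) ℂ, IsUnit T ∧ Commute T (jordanMatrix s μ) ∧
      (∀ (i j : Fin u) (hi : 0 < s i) (hj : 0 < s j), j < i → T ⟨i, 0, hi⟩ ⟨j, 0, hj⟩ = 0) ∧
      N = LinearMap.ker (shiftMatrix s k * T⁻¹).mulVecLin) ↔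
    (∀ y ∈ N.map (ext s), jordan μ y ∈ N.map (ext s)) ∧ HasProfile μ (N.map (ext s)) k ∧
      ∀ j, HasFullChain μ s k (N.map (ext s)) j := by
  have hcoord := isCoord_ext s μ
  have hker {T : Matrix (BlockIdx s) (BlockIdx s) ℂ} (hT : IsUnit T) :
      N = LinearMap.ker (shiftMatrix s k * T⁻¹).mulVecLin ↔
        N.map (ext s) = ((bounded k).comap (ext s)).map (ext s ∘ₗ T.mulVecLin) := by
    rw [ker_mul_inv _ hT, ker_shiftMatrix, Submodule.map_comp,
      (Submodule.map_injective_of_injective hcoord.injective).eq_iff]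
  have hiff := hcoord.exists_isCoord_iff (N := N.map (ext s)) hs hk
  simp only [hcoord.map_le N, true_and] at hiff
  rw [← hiff]
  constructor
  · rintro ⟨T, hT, hcomm, htri, hN⟩
    have hψ := isCoord_ext_comp_iff.2 ⟨hT, hcomm⟩
    exact ⟨_, hψ, (hasLead_ext_mulVec_iff hs hψ).2 htri, (hker hT).1 hN⟩
  · rintro ⟨ψ, hψ, hlead, hN⟩
    obtain ⟨T, rfl⟩ := exists_ext_comp_eq hψ.mem_bounded
    obtain ⟨hT, hcomm⟩ := isCoord_ext_comp_iff.1 hψ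
    exact ⟨T, hT, hcomm, (hasLead_ext_mulVec_iff hs hψ).1 hlead, (hker hT).2 hN⟩

end Matrix

end BlockSeq

lemma BlockSeq.isCoord_of_mul_eq {n u : ℕ} {A : Matrix (Fin n) (Fin n) ℂ} {s : Fin u → ℕ}
    {μ : Fin u → ℂ} {X : Matrix (Fin n) (BlockIdx s) ℂ} {Y : Matrix (BlockIdx s) (Fin n) ℂ}
    (hXY : X * Y = 1) (hYX : Y * X = 1) (hA : A = X * jordanMatrix s μ * Y) :
    IsCoord (toLin' A) s μ (ext s ∘ₗ Y.mulVecLin) where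
  injective := (isCoord_ext s μ).injective.comp <|
    Function.LeftInverse.injective (g := X.mulVec) fun v => by
      rw [mulVecLin_apply, mulVec_mulVec, hXY, one_mulVec]
  range_eq := by
    rw [LinearMap.range_comp_of_range_eq_top _ (LinearMap.range_eq_top.2 fun x =>
      ⟨X *ᵥ x, by rw [mulVecLin_apply, mulVec_mulVec, hYX, one_mulVec]⟩),
      (isCoord_ext s μ).range_eq]
  map_apply v := by
    rw [LinearMap.comp_apply, LinearMap.comp_apply, ← (isCoord_ext s μ).map_apply, toLin'_apply,
      toLin'_apply, mulVecLin_apply, mulVecLin_apply, mulVec_mulVec, mulVec_mulVec, hA,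
      Matrix.mul_assoc X, ← Matrix.mul_assoc Y, hYX, Matrix.one_mul]

lemma BlockSeq.finrank_bounded {u : ℕ} (k : Fin u → ℕ) :
    Module.finrank ℂ (bounded k : Submodule ℂ (BlockSeq ℂ (Fin u))) = ∑ j, k j := by
  rw [← (isCoord_ext k 0).range_eq, LinearMap.finrank_range_of_inj (isCoord_ext k 0).injective,
    Module.finrank_pi, Fintype.card_sigma]
  simp only [Fintype.card_fin]

namespace JordanForm

open BlockSeq

variable {n : ℕ} {A : Matrix (Fin n) (Fin n) ℂ} (F : JordanForm A)
  {N : Submodule ℂ (Fin n → ℂ)} {E : Set ℂ} {i j : Fin F.u} {k : Fin F.u → ℕ}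

/-- The Jordan coordinates of a vector, extended by zero. -/
def coord : (Fin n → ℂ) →ₗ[ℂ] BlockSeq ℂ (Fin F.u) := ext F.size ∘ₗ F.Qinv.mulVecLin

lemma isCoord : IsCoord (toLin' A) F.size F.eig F.coord :=
  isCoord_of_mul_eq F.Q_mul_Qinv F.Qinv_mul_Q F.eq_conj

lemma map_ext_pull (N : Submodule ℂ (Fin n → ℂ)) : (F.pull N).map (ext F.size) = N.map F.coord :=
  (Submodule.map_comp _ _ _).symm

lemma hasLead_ext_iff {p : ℕ} {x : BlockIdx F.size → ℂ} :
    HasLead F.eig j p (ext F.size x) ↔ ∃ w : BlockIdx F.size → ℂ,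
      w = ((jordanMatrix F.size F.eig - F.eig j • 1) ^ p) *ᵥ x ∧
      (jordanMatrix F.size F.eig - F.eig j • 1) *ᵥ w = 0 ∧
      (∃ a, w ⟨j, a⟩ ≠ 0) ∧ ∀ i, j < i → ∀ a, w ⟨i, a⟩ = 0 := by
  have hcoord := isCoord_ext F.size F.eig
  have hlin : toLin' (jordanMatrix F.size F.eig) - F.eig j • 1 =
      toLin' (jordanMatrix F.size F.eig - F.eig j • 1) := by
    rw [map_sub, map_smul, toLin'_one]
    rfl
  have hentry (w : BlockIdx F.size → ℂ) (i : Fin F.u) :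
      (∀ a, ext F.size w i a = 0) ↔ ∀ a, w ⟨i, a⟩ = 0 := by
    refine ⟨fun h a => (ext_apply_of_lt w a.2).symm.trans (h a), fun h a => ?_⟩
    by_cases ha : a < F.size i
    · rw [ext_apply_of_lt w ha, h]
    · exact ext_mem_bounded F.size w i a ha
  have hne (w : BlockIdx F.size → ℂ) : (∃ a, ext F.size w j a ≠ 0) ↔ ∃ a, w ⟨j, a⟩ ≠ 0 := by
    simpa only [not_forall] using (hentry w j).not
  rw [← hcoord.hasLead_sub_pow_iff, hcoord.hasLead_zero_iff, hlin, ← toLin'_pow, exists_eq_left]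
  simp only [toLin'_apply, hne, hentry]

lemma hasProfile (hN : N ∈ invariantLattice A) :
    HasProfile F.eig (N.map F.coord) (F.chainLength N) := by
  convert hasProfile_sSup (F.isCoord.mem_invtSubmodule_iff.1 hN) (F.isCoord.map_le N) using 2
    with j
  rw [← map_ext_pull]
  simp only [Submodule.mem_map, exists_exists_and_eq_and, hasLead_ext_iff]
  rfl

lemma chainLength_le (hN : N ∈ invariantLattice A) : F.chainLength N ≤ F.size :=
  (F.hasProfile hN).le (F.isCoord.map_le N)

section ExpandedSize

lemma expandedSize_of_mem (h : F.eig i ∈ E) :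
    F.expandedSize E i = max (F.size i) (F.maxSize (F.eig i) - 1) := if_pos h

lemma expandedSize_of_notMem (h : F.eig i ∉ E) : F.expandedSize E i = F.size i := if_neg h

lemma expandedSize_empty : F.expandedSize ∅ = F.size :=
  funext fun _ => F.expandedSize_of_notMem (Set.notMem_empty _)

lemma size_le_expandedSize (E : Set ℂ) : F.size ≤ F.expandedSize E := by
  intro i
  by_cases h : F.eig i ∈ E
  · exact F.expandedSize_of_mem h ▸ le_max_left _ _
  · exact (F.expandedSize_of_notMem h).ge

lemma size_le_maxSize (i : Fin F.u) : F.size i ≤ F.maxSize (F.eig i) :=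
  Finset.le_sup (Finset.mem_filter.2 ⟨Finset.mem_univ i, rfl⟩)

lemma lt_of_size_lt (he : F.eig i = F.eig j) (h : F.size i < F.size j) : j < i :=
  lt_of_not_ge fun hij => h.not_ge (F.size_anti i j hij he)

lemma expandedSize_le_or (hj : F.eig j ∈ E) (he : F.eig i = F.eig j) :
    F.expandedSize E j ≤ F.expandedSize E i ∨
      F.expandedSize E j ≤ F.expandedSize E i + 1 ∧ j < i := by
  have hij := F.lt_of_size_lt he
  have hi' := F.size_le_maxSize i
  have hj' := F.size_le_maxSize j
  rw [F.expandedSize_of_mem hj, F.expandedSize_of_mem (he ▸ hj), he]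
  rw [he] at hi'
  omega

end ExpandedSize

lemma ext_comp_rowSelection {u : ℕ} {s t : Fin u → ℕ} (hst : s ≤ t) :
    ext t ∘ₗ (rowSelection s t)ᵀ.mulVecLin = ext s := by
  refine LinearMap.pi_ext' fun p => LinearMap.ext_ring ?_
  obtain ⟨i, a, ha⟩ := p
  have hcol : (rowSelection s t)ᵀ.col ⟨i, a, ha⟩ = Pi.single ⟨i, a, ha.trans_le (hst i)⟩ 1 := by
    funext ⟨l, b⟩
    simp only [col_apply, transpose_apply, rowSelection, of_apply, Pi.single_apply]
    refine if_congr ⟨?_, ?_⟩ rfl rfl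
    · rintro ⟨rfl, h⟩
      exact Sigma.ext rfl (heq_of_eq (Fin.ext h.symm))
    · rintro ⟨⟩
      exact ⟨rfl, rfl⟩
  simp only [LinearMap.comp_apply, LinearMap.coe_single, mulVecLin_apply, mulVec_single_one, hcol,
    ext_single]

theorem exists_represents_iff (hk : k ≤ F.expandedSize E) :
    (∃ T, F.Represents E k T N) ↔ N ∈ invariantLattice A ∧ k = F.chainLength N ∧
      ∀ j, HasFullChain F.eig (F.expandedSize E) k (N.map F.coord) j := by
  have hcoord : ((F.pull N).map (rowSelection F.size (F.expandedSize E))ᵀ.mulVecLin).map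
      (ext (F.expandedSize E)) = N.map F.coord := by
    rw [← Submodule.map_comp, ext_comp_rowSelection (F.size_le_expandedSize E), map_ext_pull]
  refine (exists_ker_shiftMatrix_mul_inv_iff
    (fun j => (F.size_pos j).trans_le (F.size_le_expandedSize E j)) hk).trans ?_
  rw [hcoord, ← F.isCoord.mem_invtSubmodule_iff]
  refine and_congr_right fun hN => and_congr_left' ⟨fun h => h.unique (F.hasProfile hN), ?_⟩
  rintro rfl
  exact F.hasProfile hN

lemma hasFullChain_expandedSize (hN : N ∈ invariantLattice A)
    (h : F.eig j ∉ E → HasFullChain F.eig F.size (F.chainLength N) (N.map F.coord) j) :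
    HasFullChain F.eig (F.expandedSize E) (F.chainLength N) (N.map F.coord) j := by
  have hle := F.size_le_expandedSize E j
  by_cases hj : F.eig j ∈ E
  · exact (F.hasProfile hN).hasFullChain ((F.chainLength_le hN j).trans hle)
      ((F.size_pos j).trans_le hle) fun i => F.expandedSize_le_or hj
  · exact (h hj).congr fun i hi => (F.expandedSize_of_notMem (hi ▸ hj)).symm

lemma mem_invariantLattice_of_represents (hk : k ≤ F.size) (h : ∃ T, F.Represents E k T N) :
    N ∈ invariantLattice A :=
  ((F.exists_represents_iff (hk.trans (F.size_le_expandedSize E))).1 h).1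

lemma eq_chainLength_of_represents (hk : k ≤ F.size) (h : ∃ T, F.Represents E k T N) :
    k = F.chainLength N :=
  ((F.exists_represents_iff (hk.trans (F.size_le_expandedSize E))).1 h).2.1

lemma exists_represents (hN : N ∈ invariantLattice A)
    (h : ∀ j, F.eig j ∉ E → HasFullChain F.eig F.size (F.chainLength N) (N.map F.coord) j) :
    ∃ T, F.Represents E (F.chainLength N) T N :=
  (F.exists_represents_iff ((F.chainLength_le hN).trans (F.size_le_expandedSize E))).2
    ⟨hN, rfl, fun j => F.hasFullChain_expandedSize hN (h j)⟩

lemma mem_invariantLattice_iff :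
    N ∈ invariantLattice A ↔ ∃ k ≤ F.size, ∃ T, F.Represents Set.univ k T N :=
  ⟨fun hN => ⟨_, F.chainLength_le hN, F.exists_represents hN fun _ h => (h (Set.mem_univ _)).elim⟩,
    fun ⟨_, hk, h⟩ => F.mem_invariantLattice_of_represents hk h⟩

lemma sum_chainLength (hN : N ∈ invariantLattice A) :
    Module.finrank ℂ N = ∑ j, F.chainLength N j := by
  have hle := F.size_le_expandedSize Set.univ
  have hext := isCoord_ext (F.expandedSize Set.univ) F.eig
  obtain ⟨ψ, hψ, -, hmap⟩ := (hext.exists_isCoord_iff (fun j => (F.size_pos j).trans_le (hle j))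
    ((F.chainLength_le hN).trans hle)).2
    ⟨F.isCoord.mem_invtSubmodule_iff.1 hN, (F.isCoord.map_le N).trans (bounded_mono hle),
      F.hasProfile hN, fun j => F.hasFullChain_expandedSize hN fun h => (h (Set.mem_univ _)).elim⟩
  calc Module.finrank ℂ N
      = Module.finrank ℂ (N.map F.coord) :=
        (N.equivMapOfInjective F.coord F.isCoord.injective).finrank_eq
    _ = Module.finrank ℂ ((bounded (F.chainLength N)).comap (ext (F.expandedSize Set.univ))) := by
        rw [hmap]
        exact (Submodule.equivMapOfInjective ψ hψ.injective _).finrank_eq.symm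
    _ = Module.finrank ℂ (bounded (F.chainLength N) : Submodule ℂ (BlockSeq ℂ (Fin F.u))) := by
        rw [hext.finrank_comap, inf_eq_right.2 (bounded_mono ((F.chainLength_le hN).trans hle))]
    _ = ∑ j, F.chainLength N j := finrank_bounded _

end JordanForm

namespace BlockSeq

section Marked

variable {n u : ℕ} {A : Matrix (Fin n) (Fin n) ℂ} {s k : Fin u → ℕ} {μ : Fin u → ℂ}
  {φ ψ : (Fin n → ℂ) →ₗ[ℂ] BlockSeq ℂ (Fin u)}

lemma jordan_unit_zero {K ι : Type*} [Field K] (μ : ι → K) (j : ι) :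
    jordan μ (unit j 0) = μ j • unit j 0 := by
  rw [jordan_of_mem_primary (unit_mem_supported (P := fun i _ => μ i = μ j) rfl), add_eq_left]
  ext i a
  exact unit_mem_supported (P := fun _ a => a = 0) rfl i (a + 1) a.succ_ne_zero

lemma jordan_unit_succ {K ι : Type*} [Field K] (μ : ι → K) (j : ι) (a : ℕ) :
    jordan μ (unit j (a + 1)) = μ j • unit j (a + 1) + unit j a := by
  rw [jordan_of_mem_primary (unit_mem_supported (P := fun i _ => μ i = μ j) rfl),
    shift_unit (Nat.le_add_left 1 a), Nat.add_sub_cancel]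

lemma ext_comp_basisFun (k : Fin u → ℕ) :
    ext k ∘ Pi.basisFun ℂ (BlockIdx k) = fun p => unit p.1 p.2 := by
  funext ⟨i, a, ha⟩
  rw [Function.comp_apply, Pi.basisFun_apply, ext_single]

lemma IsCoord.isJordanBasis (h : IsCoord (toLin' A) s μ ψ) (hk : k ≤ s)
    {c : BlockIdx k → Fin n → ℂ} (hc : ∀ p, ψ (c p) = unit p.1 p.2) :
    IsJordanBasis A ((bounded k).comap ψ) k c := by
  have hcomp : ψ ∘ c = ext k ∘ Pi.basisFun ℂ (BlockIdx k) := by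
    rw [ext_comp_basisFun]
    exact funext hc
  refine ⟨LinearIndependent.of_comp ψ ?_, ?_, μ, fun i => ⟨fun h0 => ?_, fun a ha => ?_⟩⟩
  · rw [hcomp]
    exact (Pi.basisFun ℂ _).linearIndependent.map' _
      (LinearMap.ker_eq_bot.2 (isCoord_ext k μ).injective)
  · apply Submodule.map_injective_of_injective h.injective
    rw [Submodule.map_span, ← Set.range_comp, hcomp, Set.range_comp, ← Submodule.map_span,
      (Pi.basisFun ℂ _).span_eq, Submodule.map_top, (isCoord_ext k μ).range_eq,
      h.map_comap (bounded_mono hk)]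
  · apply h.injective
    rw [← toLin'_apply, h.map_apply, map_smul, hc, jordan_unit_zero]
  · apply h.injective
    rw [← toLin'_apply, h.map_apply, map_add, map_smul, hc, hc, jordan_unit_succ]

lemma exists_isCoord_of_isJordanBasis {b : BlockIdx s → Fin n → ℂ} (hb : IsJordanBasis A ⊤ s b) :
    ∃ μ ψ, IsCoord (toLin' A) s μ ψ ∧ ∀ p, ψ (b p) = unit p.1 p.2 := by
  obtain ⟨hli, hspan, μ, hμ⟩ := hb
  let B := Module.Basis.mk hli hspan.ge
  let ψ := ext s ∘ₗ B.equivFun.toLinearMap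
  have hψ (p : BlockIdx s) : ψ (b p) = unit p.1 p.2 := by
    rw [← Module.Basis.mk_apply hli hspan.ge p, LinearMap.comp_apply, LinearEquiv.coe_coe,
      B.equivFun_apply, B.repr_self, Finsupp.single_eq_pi_single, ext_single]
  refine ⟨μ, ψ, ⟨(isCoord_ext s μ).injective.comp B.equivFun.injective, ?_, fun v => ?_⟩, hψ⟩
  · rw [LinearMap.range_comp_of_range_eq_top _ B.equivFun.range, (isCoord_ext s μ).range_eq]
  · suffices ψ ∘ₗ toLin' A = jordan μ ∘ₗ ψ from LinearMap.congr_fun this v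
    refine B.ext fun ⟨i, a, ha⟩ => ?_
    simp only [LinearMap.comp_apply, B, Module.Basis.mk_apply, toLin'_apply, hψ]
    cases a with
    | zero => rw [(hμ i).1 ha, map_smul, hψ, jordan_unit_zero]
    | succ a => rw [(hμ i).2 a ha, map_add, map_smul, hψ, hψ, jordan_unit_succ]

end Marked

section Row

variable {K ι κ E : Type*} [Field K] [AddCommGroup E] [Module K E] {f : Module.End K E}
  {s k : ι → ℕ} {l : κ → ℕ} {μ : ι → K} {ν : κ → K} {φ : E →ₗ[K] BlockSeq K ι}
  {ψ : E →ₗ[K] BlockSeq K κ} {N : Submodule K E} {j : ι} {z : K} {p : ℕ} {v : E}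

lemma IsCoord.exists_sub_pow_eq_iff [Finite ι] (h : IsCoord f s μ φ) :
    (∃ w ∈ f.maxGenEigenspace z, ((f - z • 1) ^ p) w = v) ↔
      φ v ∈ supported fun i a => μ i = z ∧ a + p < s i := by
  constructor
  · rintro ⟨w, hw, rfl⟩
    rw [h.mem_maxGenEigenspace_iff] at hw
    rw [h.map_sub_pow hw, mem_supported]
    exact fun i a ha => ⟨mem_supported.1 hw _ _ ha, mem_supported.1 (h.mem_bounded w) _ _ ha⟩
  · intro hv
    obtain ⟨w, hw⟩ := h.exists_eq (y := unshift p (φ v)) <|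
      unshift_mem_supported.2 (supported_mono (fun _ _ => And.right) hv)
    have hprim : φ w ∈ primary μ z :=
      hw ▸ unshift_mem_supported.2 (supported_mono (fun _ _ => And.left) hv)
    exact ⟨w, h.mem_maxGenEigenspace_iff.2 hprim, h.injective <| by
      rw [h.map_sub_pow hprim, hw, shift_unshift]⟩

lemma IsCoord.sub_pow_restrict (h : IsCoord f s μ φ) {y : E}
    (hv : φ v ∈ supported fun i a => μ i = z ∧ a < p + 1)
    (hy : φ y = restrict (fun _ a => a = p) (φ v)) :
    ((f - z • 1) ^ p) y = ((f - z • 1) ^ p) v ∧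
      φ y ∈ supported fun i a => μ i = z ∧ a = p ∧ φ (((f - z • 1) ^ p) v) i 0 ≠ 0 := by
  have hvprim : φ v ∈ primary μ z := supported_mono (fun _ _ => And.left) hv
  have hyprim : φ y ∈ primary μ z := hy ▸ restrict_mem hvprim
  have hpos (i : ι) : φ y i p = φ v i p := by
    rw [hy]
    exact if_pos rfl
  have hneg {i : ι} {a : ℕ} (ha : a ≠ p) : φ y i a = 0 := by
    rw [hy]
    exact if_neg ha
  refine ⟨h.injective ?_, mem_supported.2 fun i a ha => ?_⟩
  · rw [h.map_sub_pow hyprim, h.map_sub_pow hvprim]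
    ext i a
    rw [shift_apply, shift_apply]
    rcases eq_or_ne a 0 with rfl | ha
    · rw [zero_add, hpos]
    · rw [hneg (by omega), hv i _ (by omega)]
  · obtain rfl := not_not.1 (mt hneg ha)
    refine ⟨mem_supported.1 hyprim i a ha, rfl, ?_⟩
    rwa [h.map_sub_pow hvprim, shift_apply, zero_add, ← hpos]

/-- The top row of a vector extends as far as the eigenvector at the end of its chain does, so
cutting it out leaves room for a full chain. -/
lemma IsCoord.hasFullChain_of_restrict_mem [Finite ι] [LinearOrder ι] [Finite κ]
    (hφ : IsCoord f s μ φ) (hψ : IsCoord f l ν ψ)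
    (hrow : ∀ v ∈ N, ∀ p, ∃ w ∈ N, ψ w = restrict (fun _ a => a = p) (ψ v))
    (hN : HasProfile μ (N.map φ) k) (hkj : k j ≤ s j) (hj : 0 < s j)
    (hsize : ∀ i ≤ j, μ i = μ j → s j ≤ s i) :
    HasFullChain μ s k (N.map φ) j := by
  refine hasFullChain_of_lt hkj hj fun hk => ?_
  obtain ⟨_, ⟨v, hv, rfl⟩, hlead⟩ := (hN j (k j - 1)).2 (by omega)
  obtain ⟨y, hy, hyv⟩ := hrow v hv (k j - 1)
  have hbottom := hφ.hasLead_sub_pow_iff.2 hlead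
  have hvψ : ψ v ∈ supported fun i a => ν i = μ j ∧ a < k j - 1 + 1 := by
    rw [← hψ.pow_eq_zero_iff, hφ.pow_eq_zero_iff, mem_supported]
    exact fun i a ha => ⟨mem_supported.1 hlead.mem_primary i a ha, hlead.lt_succ ha⟩
  obtain ⟨hpow, hysupp⟩ := hψ.sub_pow_restrict hvψ hyv
  have hlong : ψ (((f - μ j • 1) ^ (k j - 1)) v) ∈
      supported fun i a => ν i = μ j ∧ a + (s j - 1) < l i := by
    rw [← hψ.exists_sub_pow_eq_iff, hφ.exists_sub_pow_eq_iff, mem_supported]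
    intro i a ha
    have hi : μ i = μ j := mem_supported.1 hbottom.mem_primary i a ha
    obtain h | ⟨rfl, hij⟩ := hbottom.lt_or_eq ha
    · exact (Nat.not_lt_zero a h).elim
    · have := hsize i hij hi
      exact ⟨hi, by omega⟩
  have hylong : φ y ∈ supported fun i a => μ i = μ j ∧ a + (s j - k j) < s i := by
    rw [← hφ.exists_sub_pow_eq_iff, hψ.exists_sub_pow_eq_iff, mem_supported]
    intro i a ha
    obtain ⟨hi, rfl, h0⟩ := mem_supported.1 hysupp i a ha
    have := (mem_supported.1 hlong i 0 h0).2
    exact ⟨hi, by omega⟩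
  refine ⟨φ y, Submodule.mem_map_of_mem hy, hφ.hasLead_sub_pow_iff.1 (hpow ▸ hbottom),
    fun i a ha => ?_⟩
  have := (mem_supported.1 hylong i a ha).2
  omega

end Row

lemma IsCoord.exists_swap {K ι E : Type*} [Field K] [AddCommGroup E] [Module K E]
    {f : Module.End K E} {s : ι → ℕ} {μ : ι → K} {φ ψ : E →ₗ[K] BlockSeq K ι}
    (hφ : IsCoord f s μ φ) (hψ : IsCoord f s μ ψ) :
    ∃ χ, IsCoord f s μ χ ∧ ∀ v w, φ v = ψ w → χ v = φ w := by
  obtain ⟨g, hg⟩ := ψ.exists_leftInverse_of_injective (LinearMap.ker_eq_bot.2 hψ.injective)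
  have hswap (v w : E) (h : φ v = ψ w) : (φ ∘ₗ g ∘ₗ φ) v = φ w := by
    rw [LinearMap.comp_apply, LinearMap.comp_apply, h, ← LinearMap.comp_apply g, hg,
      LinearMap.id_apply]
  have hex (v : E) : ∃ w, φ v = ψ w := (hψ.exists_eq (hφ.mem_bounded v)).imp fun _ => Eq.symm
  refine ⟨φ ∘ₗ g ∘ₗ φ, ⟨fun v v' h => ?_, le_antisymm ?_ fun y hy => ?_, fun v => ?_⟩, hswap⟩
  · obtain ⟨w, hw⟩ := hex v
    obtain ⟨w', hw'⟩ := hex v'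
    rw [hswap v w hw, hswap v' w' hw'] at h
    exact hφ.injective (by rw [hw, hw', hφ.injective h])
  · exact (LinearMap.range_comp_le_range _ _).trans hφ.range_eq.le
  · obtain ⟨w, rfl⟩ := hφ.exists_eq hy
    obtain ⟨v, hv⟩ := hφ.exists_eq (hψ.mem_bounded w)
    exact ⟨v, hswap v w hv⟩
  · obtain ⟨w, hw⟩ := hex v
    rw [hswap v w hw, hswap (f v) (f w) (by rw [hφ.map_apply, hψ.map_apply, hw]), hφ.map_apply]

section Primary

variable {K ι : Type*} [Field K] [LinearOrder ι] {s k : ι → ℕ} {μ : ι → K}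
  {N : Submodule K (BlockSeq K ι)} {j : ι}

open Classical in
lemma HasProfile.inf_primary (h : HasProfile μ N k) (z : K) :
    HasProfile μ (N ⊓ primary μ z) fun j => if μ j = z then k j else 0 := by
  intro j a
  by_cases hj : μ j = z
  · subst hj
    simp only [if_pos, ← h j a]
    exact ⟨fun ⟨v, hv, hlead⟩ => ⟨v, hv.1, hlead⟩,
      fun ⟨v, hv, hlead⟩ => ⟨v, ⟨hv, hlead.mem_primary⟩, hlead⟩⟩
  · simp only [if_neg hj]
    exact ⟨fun ⟨v, hv, hlead⟩ => (hlead.ne_zero (hv.2 j a hj)).elim,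
      fun ha => (Nat.not_lt_zero a ha).elim⟩

open Classical in
lemma hasFullChain_inf_primary_iff {z : K} (hs : 0 < s j) :
    HasFullChain μ s (fun j => if μ j = z then k j else 0) (N ⊓ primary μ z) j ↔
      (μ j = z → HasFullChain μ s k N j) := by
  by_cases hj : μ j = z
  · subst hj
    simp only [HasFullChain, if_pos, forall_const]
    refine exists_congr fun t => and_congr_right fun _ => and_congr_right fun ht => ?_
    exact and_iff_left (shift_mem_primary _ ht.mem_primary)
  · exact iff_of_true (hasFullChain_of_lt (by simp only [if_neg hj, zero_le]) hs
      fun h => by simp only [if_neg hj, lt_irrefl] at h) fun h => (hj h).elim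

end Primary

section IsMarked

variable {n u : ℕ} {A : Matrix (Fin n) (Fin n) ℂ} {s k : Fin u → ℕ} {μ : Fin u → ℂ}
  {φ ψ : (Fin n → ℂ) →ₗ[ℂ] BlockSeq ℂ (Fin u)} {N : Submodule ℂ (Fin n → ℂ)}

lemma IsCoord.isMarked_comap_bounded (h : IsCoord (toLin' A) s μ ψ) (hk : k ≤ s) :
    IsMarked A ((bounded k).comap ψ) := by
  choose b hb using fun p : BlockIdx s => h.exists_eq (y := unit p.1 p.2) <|
    unit_mem_supported p.2.2
  refine ⟨u, k, fun p => b ⟨p.1, p.2.castLE (hk p.1)⟩, u, s, b,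
    h.isJordanBasis hk fun p => hb ⟨p.1, p.2.castLE (hk p.1)⟩, ?_, ?_⟩
  · have htop : (bounded s).comap ψ = ⊤ := eq_top_iff.2 fun v _ => h.mem_bounded v
    exact htop ▸ h.isJordanBasis le_rfl hb
  · rintro _ ⟨p, rfl⟩
    exact Set.mem_range_self _

lemma exists_isCoord_restrict_mem (h : IsMarked A N) :
    ∃ (t : ℕ) (l : Fin t → ℕ) (ν : Fin t → ℂ) (ψ : (Fin n → ℂ) →ₗ[ℂ] BlockSeq ℂ (Fin t)),
      IsCoord (toLin' A) l ν ψ ∧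
        ∀ v ∈ N, ∀ p, ∃ w ∈ N, ψ w = restrict (fun _ a => a = p) (ψ v) := by
  obtain ⟨r, m, c, t, l, b, ⟨-, rfl, -⟩, hb, hcb⟩ := h
  obtain ⟨ν, ψ, hψ, hunit⟩ := exists_isCoord_of_isJordanBasis hb
  refine ⟨t, l, ν, ψ, hψ, fun v hv p => ?_⟩
  suffices Submodule.span ℂ (Set.range c) ≤ ((Submodule.span ℂ (Set.range c)).map ψ).comap
    (restrict (fun _ a => a = p) ∘ₗ ψ) from this hv
  rw [Submodule.span_le]
  rintro _ ⟨q, rfl⟩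
  obtain ⟨q', hq'⟩ := hcb (Set.mem_range_self q)
  have hq : ψ (c q) = unit q'.1 q'.2 := hq' ▸ hunit q'
  rw [SetLike.mem_coe, Submodule.mem_comap, LinearMap.comp_apply]
  by_cases hp : (q'.2 : ℕ) = p
  · rw [restrict_eq_self (hq ▸ unit_mem_supported hp)]
    exact Submodule.mem_map_of_mem (Submodule.subset_span (Set.mem_range_self q))
  · rw [restrict_eq_zero (hq ▸ unit_mem_supported hp)]
    exact zero_mem _

theorem IsCoord.isMarked_iff (hφ : IsCoord (toLin' A) s μ φ) (hs : ∀ j, 0 < s j)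
    (hanti : ∀ i j, i ≤ j → μ i = μ j → s j ≤ s i) (hN : N ∈ invariantLattice A)
    (hprof : HasProfile μ (N.map φ) k) :
    IsMarked A N ↔ ∀ j, HasFullChain μ s k (N.map φ) j := by
  have hk : k ≤ s := hprof.le (hφ.map_le N)
  constructor
  · intro h j
    obtain ⟨t, l, ν, ψ, hψ, hrow⟩ := exists_isCoord_restrict_mem h
    exact hφ.hasFullChain_of_restrict_mem hψ hrow hprof (hk j) (hs j) fun i => hanti i j
  · intro h
    obtain ⟨ψ, hψ, -, hmap⟩ := (hφ.exists_isCoord_iff hs hk).2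
      ⟨hφ.mem_invtSubmodule_iff.1 hN, hφ.map_le N, hprof, h⟩
    obtain ⟨χ, hχ, hswap⟩ := hφ.exists_swap hψ
    suffices N = (bounded k).comap χ from this ▸ hχ.isMarked_comap_bounded hk
    ext v
    obtain ⟨w, hw⟩ := hψ.exists_eq (hφ.mem_bounded v)
    calc v ∈ N
        ↔ φ v ∈ N.map φ := by
          rw [← Submodule.mem_comap, Submodule.comap_map_eq_of_injective hφ.injective]
      _ ↔ w ∈ (bounded k).comap φ := by
          rw [hmap, ← hw, ← Submodule.mem_comap, Submodule.comap_map_eq_of_injective hψ.injective]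
      _ ↔ v ∈ (bounded k).comap χ := by
          rw [Submodule.mem_comap, Submodule.mem_comap, hswap v w hw.symm]

end IsMarked

end BlockSeq

namespace JordanForm

open BlockSeq

variable {n : ℕ} {A : Matrix (Fin n) (Fin n) ℂ} (F : JordanForm A)
  {N : Submodule ℂ (Fin n → ℂ)} {j : Fin F.u} {z : ℂ}

lemma isMarked_iff (hN : N ∈ invariantLattice A) :
    IsMarked A N ↔ ∀ j, HasFullChain F.eig F.size (F.chainLength N) (N.map F.coord) j :=
  F.isCoord.isMarked_iff F.size_pos F.size_anti hN (F.hasProfile hN)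

lemma isMarked_iff_exists_represents :
    N ∈ invariantLattice A ∧ IsMarked A N ↔ ∃ k ≤ F.size, ∃ T, F.Represents ∅ k T N := by
  constructor
  · rintro ⟨hN, hmark⟩
    exact ⟨_, F.chainLength_le hN, F.exists_represents hN fun j _ => (F.isMarked_iff hN).1 hmark j⟩
  · rintro ⟨k, hk, h⟩
    obtain ⟨hN, rfl, hfull⟩ := (F.exists_represents_iff (by rwa [expandedSize_empty])).1 h
    rw [expandedSize_empty] at hfull
    exact ⟨hN, (F.isMarked_iff hN).2 hfull⟩

lemma mem_nonMarkedEigenvalues_iff (hN : N ∈ invariantLattice A) :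
    z ∈ nonMarkedEigenvalues A N ↔
      ∃ j, F.eig j = z ∧ ¬ HasFullChain F.eig F.size (F.chainLength N) (N.map F.coord) j := by
  have hmap : (N ⊓ Module.End.maxGenEigenspace (toLin' A) z).map F.coord =
      N.map F.coord ⊓ primary F.eig z := by
    ext y
    constructor
    · rintro ⟨v, ⟨hv, hz⟩, rfl⟩
      exact ⟨Submodule.mem_map_of_mem hv, F.isCoord.mem_maxGenEigenspace_iff.1 hz⟩
    · rintro ⟨⟨v, hv, rfl⟩, hz⟩
      exact ⟨v, ⟨hv, F.isCoord.mem_maxGenEigenspace_iff.2 hz⟩, rfl⟩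
  have hinv : N ⊓ Module.End.maxGenEigenspace (toLin' A) z ∈ invariantLattice A :=
    Sublattice.inf_mem hN (Module.End.mapsTo_maxGenEigenspace_of_comm (Commute.refl _) z)
  rw [nonMarkedEigenvalues, Set.mem_ofPred_eq, F.isCoord.isMarked_iff F.size_pos F.size_anti hinv
    (hmap ▸ (F.hasProfile hN).inf_primary z), hmap]
  simp only [hasFullChain_inf_primary_iff (F.size_pos _), not_forall, exists_prop]

end JordanForm

namespace BlockSeq

section Gap

variable {K ι : Type*} [Field K] [LinearOrder ι] {s k : ι → ℕ} {μ : ι → K}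
  {N : Submodule K (BlockSeq K ι)} {i j : ι} {a : ℕ}

lemma HasProfile.exists_reduced [Finite ι] (hN : HasProfile μ N k) (hs : N ≤ bounded s)
    (ha : a < k j) : ∃ y ∈ N, HasLead μ j a y ∧
      ∀ i b, y i b ≠ 0 → i = j ∧ b = a ∨ k i ≤ b ∧ toLex (b, i) < toLex (a, j) := by
  let U : Submodule K (BlockSeq K ι) :=
    supported fun i b => μ i = μ j ∧ toLex (b, i) < toLex (a, j)
  have hlead (i : ι) (b : ℕ) (h : ∃ v ∈ U ⊓ bounded s, HasLead μ i b v) :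
      ∃ v ∈ N ⊓ U ⊔ supported (fun i b => k i ≤ b) ⊓ (U ⊓ bounded s), HasLead μ i b v := by
    obtain ⟨w, ⟨hwU, hws⟩, hw⟩ := h
    obtain ⟨hij, hlt⟩ := mem_supported.1 hwU i b hw.ne_zero
    rcases lt_or_ge b (k i) with hb | hb
    · obtain ⟨v, hv, hvlead⟩ := (hN i b).2 hb
      refine ⟨v, Submodule.mem_sup_left ⟨hv, mem_supported.2 fun l c hc => ?_⟩, hvlead⟩
      exact ⟨(mem_supported.1 hvlead.mem_primary l c hc).trans hij,
        (hvlead.toLex_le hc).trans_lt hlt⟩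
    · exact ⟨unit i b, Submodule.mem_sup_right ⟨unit_mem_supported hb,
        unit_mem_supported ⟨hij, hlt⟩, unit_mem_supported (mem_supported.1 hws i b hw.ne_zero)⟩,
        hasLead_unit μ i b⟩
  obtain ⟨y, hy, hylead⟩ := (hN j a).2 ha
  have hdiff : y - (y j a / (unit j a : BlockSeq K ι) j a) • unit j a ∈ U ⊓ bounded s :=
    ⟨hylead.sub_smul_mem (hasLead_unit μ j a), sub_mem (hs hy) (Submodule.smul_mem _ _
      (unit_mem_supported (mem_supported.1 (hs hy) j a hylead.ne_zero)))⟩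
  obtain ⟨w, hw, r, hr, hwr⟩ := Submodule.mem_sup.1 <| mem_of_hasLead (z := μ j)
    (sup_le (le_inf inf_le_right (inf_le_left.trans hs)) inf_le_right) inf_le_right hlead hdiff
    (supported_mono (fun _ _ => And.left) hdiff.1)
  set c := y j a / (unit j a : BlockSeq K ι) j a
  have hyw : y - w = c • unit j a + r := by
    rw [sub_eq_iff_eq_add, add_assoc, add_comm r, hwr, add_sub_cancel]
  refine ⟨y - w, sub_mem hy hw.1, hylead.of_sub_mem ?_, fun i b hib => ?_⟩
  · rw [sub_sub_cancel]
    exact hw.2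
  rw [hyw, Pi.add_apply, Pi.add_apply] at hib
  by_cases hunit : (unit j a : BlockSeq K ι) i b = 0
  · have hrib : r i b ≠ 0 := by
      rwa [Pi.smul_apply, Pi.smul_apply, hunit, smul_zero, zero_add] at hib
    exact Or.inr ⟨mem_supported.1 hr.1 i b hrib, (mem_supported.1 hr.2.1 i b hrib).2⟩
  · exact Or.inl (mem_supported.1 (unit_mem_supported (P := fun i b => i = j ∧ b = a) ⟨rfl, rfl⟩)
      i b hunit)

/-- Two blocks with eigenvalue `z` have powers below their sizes and differ in size and in power by
more than one, in the same direction. -/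
def HasGap (μ : ι → K) (s k : ι → ℕ) (z : K) (i j : ι) : Prop :=
  μ i = z ∧ μ j = z ∧ k i < s i ∧ k j < s j ∧ s i + 1 < s j ∧ k i + 1 < k j

lemma HasProfile.hasFullChain_of_not_hasGap [Finite ι] (hN : HasProfile μ N k)
    (hs : N ≤ bounded s) (hj : 0 < s j) (hanti : ∀ i, μ i = μ j → s i < s j → j < i)
    (hgap : ∀ i, ¬ HasGap μ s k (μ j) i j) : HasFullChain μ s k N j := by
  refine hasFullChain_of_lt (hN.le hs j) hj fun hk => ?_
  obtain ⟨y, hy, hlead, hred⟩ := hN.exists_reduced (j := j) (a := k j - 1) hs (by omega)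
  refine ⟨y, hy, hlead, fun i a ha => ?_⟩
  have hμ : μ i = μ j := mem_supported.1 hlead.mem_primary i a ha
  have has : a < s i := mem_supported.1 (hs hy) i a ha
  have hgap := hgap i
  have hanti := hanti i hμ
  rw [HasGap] at hgap
  obtain ⟨rfl, rfl⟩ | ⟨hki, hlt⟩ := hred i a ha
  · omega
  · have hlt : a < k j - 1 ∨ a = k j - 1 ∧ i < j := Prod.Lex.toLex_lt_toLex.1 hlt
    rcases lt_or_ge (s i) (s j) with hij | hij
    · have := hlt.resolve_right fun h => (hanti hij).not_gt h.2
      by_contra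
      exact hgap ⟨hμ, rfl, by omega, by omega, by omega, by omega⟩
    · omega

end Gap

section Shear

variable {K ι : Type*} [Field K] {s k : ι → ℕ} {μ : ι → K} {S : Set ι} {P : ι → ι} {d : ι → ℕ}
  {v : BlockSeq K ι}

open Classical in
/-- Copies the block `P i`, shifted by `d i`, to each block `i ∈ S`. -/
noncomputable def copy (S : Set ι) (P : ι → ι) (d : ι → ℕ) : Module.End K (BlockSeq K ι) where
  toFun v i a := if i ∈ S then v (P i) (a + d i) else 0
  map_add' v w := by ext i a; simp [ite_add_zero]
  map_smul' c v := by ext i a; simp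

lemma copy_apply_of_mem {i : ι} (hi : i ∈ S) (a : ℕ) :
    copy S P d v i a = v (P i) (a + d i) :=
  if_pos hi

lemma copy_apply_of_notMem {i : ι} (hi : i ∉ S) (a : ℕ) : copy S P d v i a = 0 := if_neg hi

lemma mem_of_copy_ne_zero {i : ι} {a : ℕ} (h : copy S P d v i a ≠ 0) :
    i ∈ S ∧ v (P i) (a + d i) ≠ 0 := by
  by_cases hi : i ∈ S
  · exact ⟨hi, by rwa [copy_apply_of_mem hi] at h⟩
  · exact absurd (copy_apply_of_notMem hi a) h

lemma copy_copy (hP : ∀ i ∈ S, P i ∉ S) : copy S P d (copy S P d v) = 0 := by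
  ext i a
  by_contra h
  obtain ⟨hi, h⟩ := mem_of_copy_ne_zero h
  exact h (copy_apply_of_notMem (hP i hi) _)

lemma jordan_copy (hμ : ∀ i ∈ S, μ (P i) = μ i) :
    jordan μ (copy S P d v) = copy S P d (jordan μ v) := by
  ext i a
  by_cases hi : i ∈ S
  · simp only [jordan_apply, copy_apply_of_mem hi, hμ i hi, add_right_comm]
  · simp only [jordan_apply, copy_apply_of_notMem hi, mul_zero, add_zero]

lemma HasLead.copy_mem [LinearOrder ι] {j : ι} {a : ℕ} (hv : HasLead μ j a v)
    (hμ : ∀ i ∈ S, μ (P i) = μ i) (hd : ∀ i ∈ S, 0 < d i) :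
    copy S P d v ∈ BlockSeq.supported fun i b => μ i = μ j ∧ toLex (b, i) < toLex (a, j) := by
  refine BlockSeq.mem_supported.2 fun i b h => ?_
  obtain ⟨hi, h⟩ := mem_of_copy_ne_zero h
  refine ⟨(hμ i hi).symm.trans (BlockSeq.mem_supported.1 hv.mem_primary _ _ h), ?_⟩
  have := hv.lt_succ h
  have := hd i hi
  exact Prod.Lex.toLex_lt_toLex.2 (Or.inl (by dsimp only; omega))

/-- The image of `bounded k` under the unipotent map `1 + copy S P d`. -/
noncomputable def sheared (S : Set ι) (P : ι → ι) (d k : ι → ℕ) : Submodule K (BlockSeq K ι) :=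
  (bounded k).comap (1 - copy S P d)

lemma mem_sheared : v ∈ sheared S P d k ↔ v - copy S P d v ∈ bounded k := Iff.rfl

lemma add_copy_mem_sheared (hP : ∀ i ∈ S, P i ∉ S) (hv : v ∈ bounded k) :
    v + copy S P d v ∈ sheared S P d k := by
  rwa [mem_sheared, map_add, copy_copy hP, add_zero, add_sub_cancel_right]

lemma jordan_mem_sheared (hμ : ∀ i ∈ S, μ (P i) = μ i) (hv : v ∈ sheared S P d k) :
    jordan μ v ∈ sheared S P d k := by
  rw [mem_sheared, ← jordan_copy hμ, ← map_sub]
  exact jordan_mem_bounded hv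

lemma sheared_le_bounded (hP : ∀ i ∈ S, P i ∉ S) (hks : k ≤ s)
    (hd : ∀ i ∈ S, k (P i) ≤ s i + d i) :
    (sheared S P d k : Submodule K (BlockSeq K ι)) ≤ bounded s := by
  refine fun v hv i a ha => ?_
  replace ha : s i ≤ a := not_lt.1 ha
  have hia := hv i a ((hks i).trans ha).not_gt
  rw [LinearMap.sub_apply, Module.End.one_apply, Pi.sub_apply, Pi.sub_apply, sub_eq_zero] at hia
  rw [hia]
  by_contra h
  obtain ⟨hi, h⟩ := mem_of_copy_ne_zero h
  have hPi := hv (P i) (a + d i) (by have := hd i hi; omega)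
  rw [LinearMap.sub_apply, Pi.sub_apply, Pi.sub_apply, copy_apply_of_notMem (hP i hi), sub_zero]
    at hPi
  exact h hPi

lemma hasProfile_sheared [LinearOrder ι] (hμ : ∀ i ∈ S, μ (P i) = μ i) (hP : ∀ i ∈ S, P i ∉ S)
    (hd : ∀ i ∈ S, 0 < d i) : HasProfile μ (sheared S P d k) k := by
  refine fun j a => ⟨fun ⟨v, hv, hl⟩ => ?_, fun ha => ⟨_,
    add_copy_mem_sheared hP (unit_mem_supported ha), (hasLead_unit μ j a).of_sub_mem ?_⟩⟩
  · exact mem_supported.1 hv j a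
      (hl.of_sub_mem (w := v - _) (by rw [sub_sub_cancel]; exact hl.copy_mem hμ hd)).ne_zero
  · rw [sub_add_cancel_left]
    exact neg_mem ((hasLead_unit μ j a).copy_mem hμ hd)

lemma hasFullChain_sheared [LinearOrder ι] {j : ι} (hP : ∀ i ∈ S, P i ∉ S)
    (hk : k j ≤ s j) (hs : 0 < s j) (hj : ∀ i ∈ S, P i ≠ j) :
    HasFullChain μ s k (sheared S P d k) j := by
  refine hasFullChain_of_lt hk hs fun h0 => ⟨unit j (k j - 1), ?_, hasLead_unit μ j _, ?_⟩
  · have hmem := add_copy_mem_sheared (S := S) (P := P) (d := d) hP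
      (unit_mem_supported (K := K) (P := fun i a => a < k i) (j := j) (a := k j - 1) (by omega))
    convert hmem
    rw [left_eq_add]
    ext i a
    by_contra h
    obtain ⟨hi, h⟩ := mem_of_copy_ne_zero h
    exact hj i hi (mem_supported.1 (unit_mem_supported (P := fun i _ => i = j) rfl) _ _ h)
  · intro i a h
    obtain ⟨rfl, rfl⟩ :=
      mem_supported.1 (unit_mem_supported (P := fun i a => i = j ∧ a = k j - 1) ⟨rfl, rfl⟩) i a h
    omega

lemma not_hasFullChain_sheared [LinearOrder ι] {i : ι} (hi : i ∈ S) (hk : k (P i) ≤ s (P i))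
    (hki : k i + d i < k (P i)) (hsi : s i + d i < s (P i)) :
    ¬ HasFullChain μ s k (sheared S P d k) (P i) := by
  rintro ⟨t, hts, ht, hmem⟩
  have hrow := hmem i (k (P i) - 1 - d i) (by omega)
  rw [LinearMap.sub_apply, Module.End.one_apply, Pi.sub_apply, Pi.sub_apply, copy_apply_of_mem hi,
    sub_eq_zero, shift_apply, shift_apply, hts i _ (by omega)] at hrow
  refine ht.ne_zero ?_
  rw [hrow]
  congr 1
  omega

end Shear

/-- Shearing: in a block `i` that has a gap with `j`, a copy of the block `j` is added, where `j` is
chosen with the largest power so that it has no gap itself. -/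
lemma exists_of_gaps {K ι : Type*} [Field K] [Finite ι] [LinearOrder ι] {s k : ι → ℕ} {μ : ι → K}
    {E : Set K} (hks : k ≤ s) (hs : ∀ i, 0 < s i)
    (hE : ∀ z ∈ E, ∃ i j, HasGap μ s k z i j) :
    ∃ N ≤ bounded s, (∀ v ∈ N, jordan μ v ∈ N) ∧ HasProfile μ N k ∧
      ∀ z, z ∈ E ↔ ∃ j, μ j = z ∧ ¬ HasFullChain μ s k N j := by
  let S : Set ι := {i | μ i ∈ E ∧ ∃ j, HasGap μ s k (μ i) i j}
  have hmax (i : ι) : ∃ j, i ∈ S →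
      HasGap μ s k (μ i) i j ∧ ∀ l, HasGap μ s k (μ i) i l → k l ≤ k j := by
    by_cases hi : i ∈ S
    · obtain ⟨j, hj, hle⟩ :=
        Set.exists_max_image _ k (Set.toFinite {j | HasGap μ s k (μ i) i j}) hi.2
      exact ⟨j, fun _ => ⟨hj, hle⟩⟩
    · exact ⟨i, fun h => absurd h hi⟩
  choose P hP using hmax
  have hgap (i) (hi : i ∈ S) : HasGap μ s k (μ i) i (P i) := (hP i hi).1
  have hμ (i) (hi : i ∈ S) : μ (P i) = μ i := (hgap i hi).2.1
  have hPS (i) (hi : i ∈ S) : P i ∉ S := by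
    rintro ⟨-, l, hl⟩
    obtain ⟨-, hli, hl⟩ := hl
    obtain ⟨-, -, h⟩ := hgap i hi
    have := (hP i hi).2 l ⟨rfl, hli.trans (hμ i hi), by omega⟩
    omega
  let d : ι → ℕ := fun i => max 1 (k (P i) - s i)
  have hd (i) (hi : i ∈ S) : 0 < d i ∧ k i + d i < k (P i) ∧ s i + d i < s (P i) ∧
      k (P i) ≤ s i + d i := by
    obtain ⟨-, -, h⟩ := hgap i hi
    simp only [d]
    omega
  refine ⟨sheared S P d k, sheared_le_bounded hPS hks fun i hi => (hd i hi).2.2.2,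
    fun v hv => jordan_mem_sheared hμ hv, hasProfile_sheared hμ hPS fun i hi => (hd i hi).1,
    fun z => ⟨fun hz => ?_, ?_⟩⟩
  · obtain ⟨i, j, hij⟩ := hE z hz
    obtain rfl : μ i = z := hij.1
    have hi : i ∈ S := ⟨hz, j, hij⟩
    exact ⟨P i, hμ i hi,
      not_hasFullChain_sheared hi (hks _) (hd i hi).2.1 (hd i hi).2.2.1⟩
  · rintro ⟨j, rfl, hj⟩
    obtain ⟨i, hi, rfl⟩ : ∃ i ∈ S, P i = j := by
      by_contra! h
      exact hj (hasFullChain_sheared hPS (hks j) (hs j) h)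
    exact (hμ i hi).symm ▸ hi.1

section ChangeOfPowers

variable {K ι E : Type*} [Field K] [AddCommGroup E] [Module K E] [FiniteDimensional K E]
  [Finite ι] [LinearOrder ι] {f : Module.End K E} {s k l : ι → ℕ} {μ : ι → K}
  {φ : E →ₗ[K] BlockSeq K ι} {N : Submodule K (BlockSeq K ι)}

lemma IsCoord.exists_change_profile (hφ : IsCoord f s μ φ) (hs : ∀ j, 0 < s j)
    (hN : ∀ y ∈ N, jordan μ y ∈ N) (hNs : N ≤ bounded s) (hprof : HasProfile μ N k)
    (hfull : ∀ j, HasFullChain μ s k N j) (hl : l ≤ s) :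
    ∃ M ≤ bounded s, (∀ y ∈ M, jordan μ y ∈ M) ∧ HasProfile μ M l ∧
      (∀ j, HasFullChain μ s l M j) ∧ (l ≤ k → M ≤ N) ∧ (k ≤ l → N ≤ M) := by
  obtain ⟨ψ, hψ, h0, rfl⟩ :=
    (hφ.exists_isCoord_iff hs (hprof.le hNs)).2 ⟨hN, hNs, hprof, hfull⟩
  obtain ⟨hM, hMs, hMprof, hMfull⟩ := (hφ.exists_isCoord_iff hs hl).1 ⟨ψ, hψ, h0, rfl⟩
  exact ⟨_, hMs, hM, hMprof, hMfull,
    fun h => Submodule.map_mono (Submodule.comap_mono (bounded_mono h)),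
    fun h => Submodule.map_mono (Submodule.comap_mono (bounded_mono h))⟩

end ChangeOfPowers

section Move

variable {K ι : Type*} [Field K] {s : ι → ℕ} {μ : ι → K} {i j l : ι} {c : ℕ} {y : BlockSeq K ι}

open Classical in
/-- The map that takes the `i`-th sequence to block `j`, moved `c` positions towards the beginning,
and deletes everything else. -/
noncomputable def move (i j : ι) (c : ℕ) : Module.End K (BlockSeq K ι) :=
  LinearMap.single K _ j ∘ₗ LinearMap.proj i ∘ₗ shift c

lemma move_apply_self (a : ℕ) : move i j c y j a = y i (a + c) := by simp [move]

lemma move_apply_of_ne (h : l ≠ j) : move i j c y l = 0 := by simp [move, h]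

lemma move_mem_bounded (hc : s i ≤ s j + c) (hy : y ∈ bounded s) : move i j c y ∈ bounded s := by
  intro l a ha
  by_cases hl : l = j
  · subst hl
    rw [move_apply_self]
    exact hy i _ (by omega)
  · rw [move_apply_of_ne hl]
    rfl

lemma move_jordan (hij : μ i = μ j) : move i j c (jordan μ y) = jordan μ (move i j c y) := by
  ext l a
  by_cases hl : l = j
  · subst hl
    simp only [move_apply_self, jordan_apply, hij, add_right_comm]
  · simp [jordan_apply, move_apply_of_ne hl]

end Move

namespace IsCoord

variable {K ι E : Type*} [Field K] [AddCommGroup E] [Module K E] {f g : Module.End K E}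
  {s k : ι → ℕ} {μ : ι → K} {φ : E →ₗ[K] BlockSeq K ι} {N : Submodule K E} {i j : ι} {c : ℕ}
  {v : E} {y : BlockSeq K ι}

lemma commute_mem_comap_bounded [Finite ι] (h : IsCoord f s μ φ) (hg : Commute f g) (hk : k ≤ s)
    (hks : ∀ i j, μ i = μ j → k j ≤ k i ∨ s i + k j ≤ s j + k i) (hv : φ v ∈ bounded k) :
    φ (g v) ∈ bounded k := by
  suffices hmem : φ v ∈ (((bounded k).comap (φ ∘ₗ g)).map φ) by
    obtain ⟨w, hw, hwv⟩ := hmem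
    rwa [← h.injective hwv]
  refine mem_of_unit_mem hv fun j a ha => ?_
  replace ha : a < k j := mem_supported.1 hv j a ha
  have hkj : k j ≤ s j := hk j
  obtain ⟨w, hw⟩ := h.exists_eq (unit_mem_supported (ha.trans_le hkj))
  refine ⟨w, supported_mono (fun i b hb => ?_) (h.map_commute_of_eq_unit hg (by omega) hw), hw⟩
  have := hks i j hb.1
  omega

lemma move_mem_map (h : IsCoord f s μ φ) (hN : ∀ g, Commute f g → N ∈ g.invtSubmodule)
    (hij : μ i = μ j) (hc : s i ≤ s j + c) (hy : y ∈ N.map φ) : move i j c y ∈ N.map φ := by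
  obtain ⟨v, hv, rfl⟩ := hy
  obtain ⟨g, hg, hgv⟩ := h.exists_commute_lift (ψ := move i j c ∘ₗ φ)
    (fun v => move_mem_bounded hc (h.mem_bounded v)) fun v => by
      rw [LinearMap.comp_apply, h.map_apply, move_jordan hij, LinearMap.comp_apply]
  exact ⟨g v, hN g hg hv, hgv v⟩

lemma map_eq_bounded_of_hyperinvariant [Finite ι] [LinearOrder ι] (h : IsCoord f s μ φ)
    (hN : ∀ g, Commute f g → N ∈ g.invtSubmodule) (hprof : HasProfile μ (N.map φ) k) :
    N.map φ = bounded k := by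
  refine hprof.eq_of_le (hasProfile_bounded μ k) (fun y hy => mem_supported.2 fun i a ha => ?_)
    le_rfl (isGraded_supported μ _)
  have hmem := h.move_mem_map (c := 0) hN (i := i) (j := i) rfl le_rfl hy
  have hself (l b) (hb : move i i 0 y l b ≠ 0) : l = i :=
    by_contra fun hl => hb (by rw [move_apply_of_ne hl, Pi.zero_apply])
  have ha' : move i i 0 y i a ≠ 0 := by rwa [move_apply_self]
  obtain ⟨j, b, -, hlead⟩ := exists_hasLead (h.map_le N hmem)
    (mem_supported.2 fun l b hb => congrArg μ (hself l b hb)) (ne_of_apply_ne (· i a) ha')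
  obtain rfl := hself j b hlead.ne_zero
  have hb := (hprof j b).1 ⟨_, hmem, hlead⟩
  have := hlead.lt_succ ha'
  omega

lemma le_add_of_hyperinvariant [Finite ι] [LinearOrder ι] (h : IsCoord f s μ φ)
    (hN : ∀ g, Commute f g → N ∈ g.invtSubmodule) (hprof : HasProfile μ (N.map φ) k)
    (hij : μ i = μ j) (hc : s i ≤ s j + c) : k i ≤ k j + c := by
  refine le_of_forall_lt fun a ha => ?_
  have hmap := h.map_eq_bounded_of_hyperinvariant hN hprof
  rcases lt_or_ge a c with hac | hac
  · exact hac.trans_le (Nat.le_add_left _ _)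
  · have hmem := h.move_mem_map hN hij hc (y := unit i a) (hmap ▸ unit_mem_supported ha)
    rw [hmap] at hmem
    have := mem_supported.1 hmem j (a - c) (by simp [move_apply_self, Nat.sub_add_cancel hac])
    omega

end IsCoord

end BlockSeq

lemma mem_hyperinvariantLattice {n : ℕ} {A : Matrix (Fin n) (Fin n) ℂ}
    {N : Submodule ℂ (Fin n → ℂ)} :
    N ∈ hyperinvariantLattice A ↔
      ∀ g : Module.End ℂ (Fin n → ℂ), Commute (toLin' A) g → N ∈ g.invtSubmodule := by
  simp only [hyperinvariantLattice, Sublattice.mem_iInf, Subtype.forall]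
  refine ⟨fun h g hg => ?_, fun h B hB => h _ (hB.map toLinAlgEquiv')⟩
  have hcomm : Commute A (LinearMap.toMatrix' g) := by
    rw [← LinearMap.toMatrix'_toLin' A]
    exact hg.map LinearMap.toMatrixAlgEquiv'
  have hN := h _ hcomm
  rwa [invariantLattice, toLin'_toMatrix'] at hN

lemma hyperinvariantLattice_le {n : ℕ} (A : Matrix (Fin n) (Fin n) ℂ) :
    hyperinvariantLattice A ≤ invariantLattice A :=
  fun _ hN => mem_hyperinvariantLattice.1 hN _ (Commute.refl _)

lemma sigma_shiftMatrix_injective {u : ℕ} {s t k l : Fin u → ℕ} (hk : k ≤ s) (hl : l ≤ t)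
    (h : (⟨s, shiftMatrix s k⟩ : Σ s : Fin u → ℕ, Matrix (BlockIdx s) (BlockIdx s) ℂ) =
      ⟨t, shiftMatrix t l⟩) : s = t ∧ k = l := by
  rw [Sigma.mk.injEq] at h
  obtain ⟨rfl, h⟩ := h
  exact ⟨rfl, BlockSeq.shiftMatrix_injOn s hk hl (eq_of_heq h)⟩

namespace JordanForm

open BlockSeq

variable {n : ℕ} {A : Matrix (Fin n) (Fin n) ℂ} (F : JordanForm A)
  {N M : Submodule ℂ (Fin n → ℂ)} {E E' : Set ℂ} {z : ℂ} {k r : Fin F.u → ℕ}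

lemma chainLength_mono (hN : N ∈ invariantLattice A) (hM : M ∈ invariantLattice A) (h : N ≤ M) :
    F.chainLength N ≤ F.chainLength M :=
  (F.hasProfile hN).mono (F.hasProfile hM) (Submodule.map_mono h)

lemma exists_of_hasProfile {W : Submodule ℂ (BlockSeq ℂ (Fin F.u))} (hs : W ≤ bounded F.size)
    (hW : ∀ y ∈ W, jordan F.eig y ∈ W) (hprof : HasProfile F.eig W k) :
    ∃ N ∈ invariantLattice A, N.map F.coord = W ∧ F.chainLength N = k := by
  have hmap := F.isCoord.map_comap hs
  have hN : W.comap F.coord ∈ invariantLattice A :=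
    F.isCoord.mem_invtSubmodule_iff.2 (by rwa [hmap])
  refine ⟨_, hN, hmap, (F.hasProfile hN).unique ?_⟩
  rwa [hmap]

section Gap

lemma exists_hasGap (hN : N ∈ invariantLattice A) (hz : z ∈ nonMarkedEigenvalues A N) :
    ∃ i j, HasGap F.eig F.size (F.chainLength N) z i j := by
  obtain ⟨j, rfl, hj⟩ := (F.mem_nonMarkedEigenvalues_iff hN).1 hz
  by_contra! h
  exact hj ((F.hasProfile hN).hasFullChain_of_not_hasGap (F.isCoord.map_le N) (F.size_pos j)
    (fun _ => F.lt_of_size_lt) fun i => h i j)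

lemma exists_of_hasGap (hk : k ≤ F.size) (hE : ∀ z ∈ E, ∃ i j, HasGap F.eig F.size k z i j) :
    ∃ N ∈ invariantLattice A, F.chainLength N = k ∧ nonMarkedEigenvalues A N = E := by
  obtain ⟨W, hs, hW, hprof, hiff⟩ := exists_of_gaps hk F.size_pos hE
  obtain ⟨N, hN, rfl, rfl⟩ := F.exists_of_hasProfile hs hW hprof
  exact ⟨N, hN, rfl, Set.ext fun z => (F.mem_nonMarkedEigenvalues_iff hN).trans (hiff z).symm⟩

lemma subset_of_expandedSize_eq (hE : ∀ z ∈ E, ∃ i j, HasGap F.eig F.size k z i j)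
    (h : F.expandedSize E = F.expandedSize E') : E ⊆ E' := by
  intro z hz
  obtain ⟨i, j, rfl, hj, -, -, hs, -⟩ := hE z hz
  by_contra hzE
  have hi := congrFun h i
  rw [F.expandedSize_of_mem hz, F.expandedSize_of_notMem hzE] at hi
  have := hj ▸ F.size_le_maxSize j
  omega

end Gap

section Produces

lemma produces_iff (hN : N ∈ invariantLattice A)
    {Z : Σ s : Fin F.u → ℕ, Matrix (BlockIdx s) (BlockIdx s) ℂ} :
    F.Produces N Z ↔ Z = ⟨F.expandedSize (nonMarkedEigenvalues A N),
      shiftMatrix _ (F.chainLength N)⟩ := by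
  constructor
  · rintro ⟨k, hk, hT, rfl⟩
    rw [F.eq_chainLength_of_represents hk hT]
  · rintro rfl
    refine ⟨_, F.chainLength_le hN, F.exists_represents hN fun j hj => ?_, rfl⟩
    by_contra hfull
    exact hj ((F.mem_nonMarkedEigenvalues_iff hN).2 ⟨j, rfl, hfull⟩)

include F in
lemma nonMarkedEigenvalues_eq_empty_iff (hN : N ∈ invariantLattice A) :
    nonMarkedEigenvalues A N = ∅ ↔ IsMarked A N := by
  simp only [F.isMarked_iff hN, Set.eq_empty_iff_forall_notMem, F.mem_nonMarkedEigenvalues_iff hN,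
    not_exists, not_and, not_not]
  exact ⟨fun h j => h _ j rfl, fun h _ j _ => h j⟩

lemma produces_size_iff (hN : N ∈ invariantLattice A) (hr : r ≤ F.size) :
    F.Produces N ⟨F.size, shiftMatrix F.size r⟩ ↔ IsMarked A N ∧ F.chainLength N = r := by
  rw [F.produces_iff hN, ← F.nonMarkedEigenvalues_eq_empty_iff hN]
  constructor
  · intro h
    obtain ⟨hsize, rfl⟩ := sigma_shiftMatrix_injective hr
      ((F.chainLength_le hN).trans (F.size_le_expandedSize _)) h
    exact ⟨Set.subset_empty_iff.1 (F.subset_of_expandedSize_eq (fun _ => F.exists_hasGap hN)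
      (by rw [← hsize, expandedSize_empty])), rfl⟩
  · rintro ⟨hE, rfl⟩
    rw [hE, expandedSize_empty]

end Produces

section ChangeOfPowers

lemma exists_le_chainLength_eq (hN : N ∈ invariantLattice A) (hk : k ≤ F.chainLength N) :
    ∃ N' ∈ invariantLattice A, N' ≤ N ∧ F.chainLength N' = k := by
  have hle := F.size_le_expandedSize Set.univ
  obtain ⟨W, -, hW, hprof, -, hWN, -⟩ := (isCoord_ext _ F.eig).exists_change_profile
    (fun j => (F.size_pos j).trans_le (hle j)) (F.isCoord.mem_invtSubmodule_iff.1 hN)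
    ((F.isCoord.map_le N).trans (bounded_mono hle)) (F.hasProfile hN)
    (fun j => F.hasFullChain_expandedSize hN fun h => (h (Set.mem_univ _)).elim)
    (hk.trans ((F.chainLength_le hN).trans hle))
  obtain ⟨N', hN', rfl, hk'⟩ :=
    F.exists_of_hasProfile ((hWN hk).trans (F.isCoord.map_le N)) hW hprof
  exact ⟨N', hN', (Submodule.map_le_map_iff_of_injective F.isCoord.injective _ _).1 (hWN hk), hk'⟩

lemma exists_ge_isMarked_chainLength_eq (hN : N ∈ invariantLattice A) (hmark : IsMarked A N)
    (hk : F.chainLength N ≤ k) (hks : k ≤ F.size) :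
    ∃ N' ∈ invariantLattice A, N ≤ N' ∧ IsMarked A N' ∧ F.chainLength N' = k := by
  obtain ⟨W, hs, hW, hprof, hfull, -, hNW⟩ := F.isCoord.exists_change_profile F.size_pos
    (F.isCoord.mem_invtSubmodule_iff.1 hN) (F.isCoord.map_le N) (F.hasProfile hN)
    ((F.isMarked_iff hN).1 hmark) hks
  obtain ⟨N', hN', rfl, rfl⟩ := F.exists_of_hasProfile hs hW hprof
  exact ⟨N', hN', (Submodule.map_le_map_iff_of_injective F.isCoord.injective _ _).1 (hNW hk),
    (F.isMarked_iff hN').2 hfull, rfl⟩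

end ChangeOfPowers

section Initial

/-- The subspace spanned by the first `r i` vectors of each block `i`. -/
noncomputable def initial (r : Fin F.u → ℕ) : Submodule ℂ (Fin n → ℂ) := (bounded r).comap F.coord

lemma map_initial (hr : r ≤ F.size) : (F.initial r).map F.coord = bounded r :=
  F.isCoord.map_comap (bounded_mono hr)

lemma eq_initial_iff (hr : r ≤ F.size) : N = F.initial r ↔ N.map F.coord = bounded r := by
  rw [← F.map_initial hr]
  exact (Submodule.map_injective_of_injective F.isCoord.injective).eq_iff.symm

lemma initial_mono {q : Fin F.u → ℕ} (h : r ≤ q) : F.initial r ≤ F.initial q :=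
  Submodule.comap_mono (bounded_mono h)

lemma initial_mem (r : Fin F.u → ℕ) : F.initial r ∈ invariantLattice A := by
  intro v hv
  rw [Submodule.mem_comap, initial, Submodule.mem_comap, F.isCoord.map_apply]
  exact jordan_mem_bounded hv

lemma chainLength_initial (hr : r ≤ F.size) : F.chainLength (F.initial r) = r :=
  (F.hasProfile (F.initial_mem r)).unique (F.map_initial hr ▸ hasProfile_bounded F.eig r)

lemma isMarked_initial (hr : r ≤ F.size) : IsMarked A (F.initial r) := by
  rw [F.isMarked_iff (F.initial_mem r), F.chainLength_initial hr, F.map_initial hr]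
  intro j
  have hj := F.size_pos j
  refine ⟨unit j (F.size j - 1), unit_mem_supported (by omega), hasLead_unit _ j _, ?_⟩
  refine shift_mem_supported (P := fun i a => i = j ∧ a < F.size j) (fun i a h => ?_)
    (unit_mem_supported ⟨rfl, by omega⟩)
  obtain ⟨rfl, h⟩ := h
  have := hr i
  omega

lemma produces_initial (hr : r ≤ F.size) :
    F.Produces (F.initial r) ⟨F.size, shiftMatrix F.size r⟩ :=
  (F.produces_size_iff (F.initial_mem r) hr).2 ⟨F.isMarked_initial hr, F.chainLength_initial hr⟩

lemma initial_inf (r q : Fin F.u → ℕ) : F.initial (r ⊓ q) = F.initial r ⊓ F.initial q := by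
  refine (le_inf (F.initial_mono inf_le_left) (F.initial_mono inf_le_right)).antisymm ?_
  rintro v ⟨hr, hq⟩
  exact mem_supported.2 fun i a ha =>
    lt_inf_iff.2 ⟨mem_supported.1 hr i a ha, mem_supported.1 hq i a ha⟩

lemma initial_sup {q : Fin F.u → ℕ} (hr : r ≤ F.size) (hq : q ≤ F.size) :
    F.initial (r ⊔ q) = F.initial r ⊔ F.initial q := by
  symm
  rw [F.eq_initial_iff (sup_le hr hq), Submodule.map_sup, F.map_initial hr, F.map_initial hq]
  refine (sup_le (bounded_mono le_sup_left) (bounded_mono le_sup_right)).antisymm fun v hv =>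
    mem_of_unit_mem hv fun i a ha => ?_
  rcases lt_sup_iff.1 (mem_supported.1 hv i a ha) with h | h
  · exact Submodule.mem_sup_left (unit_mem_supported h)
  · exact Submodule.mem_sup_right (unit_mem_supported h)

end Initial

section Hyperinvariant

lemma commute_coord_mem_bounded {g : Module.End ℂ (Fin n → ℂ)} (hg : Commute (toLin' A) g)
    (hr : r ∈ F.hyperPowers) {v : Fin n → ℂ} (hv : F.coord v ∈ bounded r) :
    F.coord (g v) ∈ bounded r := by
  refine F.isCoord.commute_mem_comap_bounded hg hr.1 (fun i j he => ?_) hv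
  rcases le_total i j with hij | hij
  · exact Or.inl (hr.2 i j hij he).1
  · have := (hr.2 j i hij he.symm).2
    have hi : r i ≤ F.size i := hr.1 i
    have hj : r j ≤ F.size j := hr.1 j
    omega

lemma initial_mem_hyperinvariantLattice (hr : r ∈ F.hyperPowers) :
    F.initial r ∈ hyperinvariantLattice A :=
  mem_hyperinvariantLattice.2 fun _ hg _ => F.commute_coord_mem_bounded hg hr

lemma chainLength_mem_hyperPowers (hN : N ∈ hyperinvariantLattice A) :
    F.chainLength N ∈ F.hyperPowers := by
  have hN' := hyperinvariantLattice_le A hN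
  have hle {i j : Fin F.u} {c : ℕ} :=
    F.isCoord.le_add_of_hyperinvariant (i := i) (j := j) (c := c)
      (mem_hyperinvariantLattice.1 hN) (F.hasProfile hN')
  refine ⟨F.chainLength_le hN', fun i j hij he => ?_⟩
  have hsize := F.size_anti i j hij he
  have hij' := hle (i := j) (j := i) (c := 0) he.symm hsize
  have hji := hle (i := i) (j := j) (c := F.size i - F.size j) he (by omega)
  omega

lemma eq_initial_chainLength (hN : N ∈ hyperinvariantLattice A) :
    N = F.initial (F.chainLength N) := by
  have hN' := hyperinvariantLattice_le A hN
  exact (F.eq_initial_iff (F.chainLength_le hN')).2 <|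
    F.isCoord.map_eq_bounded_of_hyperinvariant (mem_hyperinvariantLattice.1 hN) (F.hasProfile hN')

lemma produces_of_mem_hyperinvariantLattice (hN : N ∈ hyperinvariantLattice A) :
    F.Produces N ⟨F.size, shiftMatrix F.size (F.chainLength N)⟩ := by
  have := F.produces_initial (F.chainLength_le (hyperinvariantLattice_le A hN))
  rwa [← F.eq_initial_chainLength hN] at this

lemma eq_initial_of_isMarked (hN : N ∈ invariantLattice A) (hmark : IsMarked A N)
    (hr : F.chainLength N ∈ F.hyperPowers) : N = F.initial (F.chainLength N) := by
  obtain ⟨ψ, hψ, -, hmap⟩ := (F.isCoord.exists_isCoord_iff F.size_pos hr.1).2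
    ⟨F.isCoord.mem_invtSubmodule_iff.1 hN, F.isCoord.map_le N, F.hasProfile hN,
      (F.isMarked_iff hN).1 hmark⟩
  obtain ⟨g, hg, hgψ⟩ := F.isCoord.exists_commute_lift hψ.mem_bounded hψ.map_apply
  refine (F.eq_initial_iff hr.1).2 <| (F.hasProfile hN).eq_of_le (hasProfile_bounded _ _) ?_ le_rfl
    (isGraded_supported _ _)
  rw [hmap]
  rintro _ ⟨v, hv, rfl⟩
  rw [← hgψ]
  exact F.commute_coord_mem_bounded hg hr hv

lemma mem_hyperinvariantLattice_iff :
    N ∈ hyperinvariantLattice A ↔ ∃ r ∈ F.hyperPowers, N ∈ invariantLattice A ∧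
      F.Produces N ⟨F.size, shiftMatrix F.size r⟩ := by
  constructor
  · exact fun hN => ⟨_, F.chainLength_mem_hyperPowers hN, hyperinvariantLattice_le A hN,
      F.produces_of_mem_hyperinvariantLattice hN⟩
  · rintro ⟨r, hr, hN, hp⟩
    obtain ⟨hmark, rfl⟩ := (F.produces_size_iff hN hr.1).1 hp
    rw [F.eq_initial_of_isMarked hN hmark hr]
    exact F.initial_mem_hyperinvariantLattice hr

end Hyperinvariant

section Correspondences

/-- The order isomorphism `k ↦ Z(k)` from the powers to the matrices `Z`. -/
noncomputable def powersOrderIso : Set.Iic F.size ≃o F.ZMatrix where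
  toEquiv := Equiv.ofBijective (fun k => ⟨shiftMatrix (F.expandedSize Set.univ) k, k, k.2, rfl⟩)
    ⟨fun k l h => Subtype.ext (shiftMatrix_injOn _ (k.2.trans (F.size_le_expandedSize _))
      (l.2.trans (F.size_le_expandedSize _)) (congrArg Subtype.val h)),
      fun ⟨_, k, hk, h⟩ => ⟨⟨k, hk⟩, Subtype.ext h.symm⟩⟩
  map_rel_iff' {k _} := ker_shiftMatrix_le_iff (k.2.trans (F.size_le_expandedSize _))

lemma powersOrderIso_apply (k : Set.Iic F.size) :
    (F.powersOrderIso k).1 = shiftMatrix (F.expandedSize Set.univ) k := rfl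

/-- The order isomorphism that takes the type of an invariant subspace to its chain lengths. -/
noncomputable def typesOrderIso : F.InvType ≃o Set.Iic F.size where
  toEquiv := Equiv.ofBijective
    (Quotient.lift (fun N => ⟨F.chainLength N.1, F.chainLength_le N.2⟩) fun _ _ h => Subtype.ext h)
    ⟨fun x y => Quotient.inductionOn₂ x y fun _ _ h => Quotient.sound (congrArg Subtype.val h),
      fun ⟨k, hk⟩ => ⟨Quotient.mk _ ⟨F.initial k, F.initial_mem k⟩,
        Subtype.ext (F.chainLength_initial hk)⟩⟩
  map_rel_iff' {x y} := by
    induction x, y using Quotient.inductionOn₂ with | _ N M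
    constructor
    · intro h
      exact ⟨⟨_, F.initial_mem _⟩, ⟨_, F.initial_mem _⟩, F.initial_mono h,
        Quotient.sound (F.chainLength_initial (F.chainLength_le N.2)),
        Quotient.sound (F.chainLength_initial (F.chainLength_le M.2))⟩
    · rintro ⟨N', M', h, hN, hM⟩
      have hN' : F.chainLength N' = F.chainLength N := Quotient.exact hN
      have hM' : F.chainLength M' = F.chainLength M := Quotient.exact hM
      change F.chainLength N ≤ F.chainLength M
      rw [← hN', ← hM']
      exact F.chainLength_mono N'.2 M'.2 h

lemma typesOrderIso_mk (N : invariantLattice A) :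
    (F.typesOrderIso (Quotient.mk _ N)).1 = F.chainLength N.1 := rfl

lemma exists_represents_iff_powersOrderIso_typesOrderIso (N : invariantLattice A)
    (hk : k ≤ F.size) :
    (∃ T, F.Represents Set.univ k T N.1) ↔
      (F.typesOrderIso.trans F.powersOrderIso (Quotient.mk _ N)).1 =
        shiftMatrix (F.expandedSize Set.univ) k := by
  have hle := F.size_le_expandedSize Set.univ
  rw [OrderIso.trans_apply, powersOrderIso_apply, typesOrderIso_mk]
  refine ⟨fun h => by rw [F.eq_chainLength_of_represents hk h], fun h => ?_⟩
  rw [← shiftMatrix_injOn _ ((F.chainLength_le N.2).trans hle) (hk.trans hle) h]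
  exact F.exists_represents N.2 fun _ h => (h (Set.mem_univ _)).elim

/-- The matrix constructed for an invariant subspace by expanding only where it is not marked. -/
noncomputable def producedMatrix (N : invariantLattice A) : F.zList :=
  ⟨⟨F.expandedSize (nonMarkedEigenvalues A N.1), shiftMatrix _ (F.chainLength N.1)⟩,
    F.chainLength N.1, F.chainLength_le N.2, nonMarkedEigenvalues A N.1,
    fun _ => F.exists_hasGap N.2, rfl⟩

lemma producedMatrix_eq_iff {N M : invariantLattice A} :
    F.producedMatrix N = F.producedMatrix M ↔ F.refinedSetoid N M := by
  constructor
  · intro h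
    obtain ⟨hsize, hk⟩ := sigma_shiftMatrix_injective
      ((F.chainLength_le N.2).trans (F.size_le_expandedSize _))
      ((F.chainLength_le M.2).trans (F.size_le_expandedSize _)) (congrArg Subtype.val h)
    exact Prod.ext hk
      ((F.subset_of_expandedSize_eq (fun _ => F.exists_hasGap N.2) hsize).antisymm
        (F.subset_of_expandedSize_eq (fun _ => F.exists_hasGap M.2) hsize.symm))
  · intro h
    obtain ⟨hk, hE⟩ := Prod.mk.inj h
    apply Subtype.ext
    simp only [producedMatrix]
    rw [hk, hE]

lemma producedMatrix_surjective : Function.Surjective F.producedMatrix := by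
  rintro ⟨_, k, hk, E, hE, rfl⟩
  obtain ⟨N, hN, hk', hE'⟩ := F.exists_of_hasGap hk hE
  subst hk' hE'
  exact ⟨⟨N, hN⟩, rfl⟩

/-- The bijection from refined types to the matrices constructed by expanding only where
needed. -/
noncomputable def refinedTypesEquiv : Quotient F.refinedSetoid ≃ F.zList :=
  Equiv.ofBijective (Quotient.lift F.producedMatrix fun _ _ => F.producedMatrix_eq_iff.2)
    ⟨fun x y => Quotient.inductionOn₂ x y fun _ _ h => Quotient.sound (F.producedMatrix_eq_iff.1 h),
      Quotient.lift_surjective _ _ F.producedMatrix_surjective⟩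

lemma produces_iff_refinedTypesEquiv (N : invariantLattice A)
    (Z : Σ s : Fin F.u → ℕ, Matrix (BlockIdx s) (BlockIdx s) ℂ) :
    F.Produces N.1 Z ↔ (F.refinedTypesEquiv (Quotient.mk _ N)).1 = Z :=
  (F.produces_iff N.2).trans eq_comm

/-- The lattice homomorphism `r ↦ initial r`. -/
noncomputable def initialHom : LatticeHom (Set.Iic F.size) (invariantLattice A) where
  toFun k := ⟨F.initial k, F.initial_mem k⟩
  map_sup' k l := Subtype.ext (F.initial_sup k.2 l.2)
  map_inf' k l := Subtype.ext (F.initial_inf k l)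

/-- The order isomorphism that takes a hyperinvariant subspace to its powers. -/
noncomputable def hyperinvariantOrderIso : hyperinvariantLattice A ≃o F.hyperPowers where
  toFun N := ⟨F.chainLength N.1, F.chainLength_mem_hyperPowers N.2⟩
  invFun r := ⟨F.initial r, F.initial_mem_hyperinvariantLattice r.2⟩
  left_inv N := Subtype.ext (F.eq_initial_chainLength N.2).symm
  right_inv r := Subtype.ext (F.chainLength_initial r.2.1)
  map_rel_iff' {N M} := by
    refine ⟨fun h => ?_, F.chainLength_mono (hyperinvariantLattice_le A N.2)
      (hyperinvariantLattice_le A M.2)⟩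
    change N.1 ≤ M.1
    rw [F.eq_initial_chainLength N.2, F.eq_initial_chainLength M.2]
    exact F.initial_mono h

end Correspondences

end JordanForm

section CyclicDecomposition

open Polynomial

variable {K V ι : Type*} [Field K] [AddCommGroup V] [Module K V] {f : Module.End K V}

/-- `V` is the direct sum of the cyclic `K[X]`-submodules generated by the vectors `x i`, where
`X` acts as `f` and the order ideal of `x i` is generated by `(X - μ i) ^ e i`. -/
structure IsCyclicDecomp [Fintype ι] (f : Module.End K V) (μ : ι → K) (e : ι → ℕ) (x : ι → V) :
    Prop where
  exists_sum_eq : ∀ v, ∃ q : ι → K[X], ∑ i, aeval f (q i) (x i) = v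
  sum_eq_zero_iff : ∀ q : ι → K[X],
    ∑ i, aeval f (q i) (x i) = 0 ↔ ∀ i, (X - C (μ i)) ^ e i ∣ q i

lemma exists_associated_X_sub_C [IsAlgClosed K] {p : K[X]} (hp : Irreducible p) :
    ∃ z, Associated (X - C z) p := by
  obtain ⟨z, hz⟩ := IsAlgClosed.exists_root p (degree_pos_of_irreducible hp).ne'
  exact ⟨z, (irreducible_X_sub_C z).associated_of_dvd hp (dvd_iff_isRoot.2 hz)⟩

theorem exists_isCyclicDecomp.{v} {K : Type v} {V : Type*} [Field K] [IsAlgClosed K]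
    [AddCommGroup V] [Module K V] [FiniteDimensional K V] (f : Module.End K V) :
    ∃ (ι : Type v) (_ : Fintype ι) (μ : ι → K) (e : ι → ℕ) (x : ι → V),
      IsCyclicDecomp f μ e x := by
  classical
  obtain ⟨ι, _, p, hp, e, ⟨E⟩⟩ := Module.equiv_directSum_of_isTorsion
    (Module.AEval.isTorsion_of_finiteDimensional K V f)
  choose μ hμ using fun i => exists_associated_X_sub_C (hp i)
  let E' := (E.trans (DirectSum.linearEquivFunOnFintype K[X] ι _)).symm
  let x (i : ι) : V := (Module.AEval.of K V f).symm
    (E' (Pi.single i (Submodule.Quotient.mk 1)))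
  have hsum (q : ι → K[X]) : ∑ i, aeval f (q i) (x i) =
      (Module.AEval.of K V f).symm (E' fun i => Submodule.Quotient.mk (q i)) := by
    simp only [x, ← Module.End.smul_def, ← Module.AEval.of_symm_smul, ← map_smul, ← map_sum,
      ← Pi.single_smul, ← Submodule.Quotient.mk_smul, smul_eq_mul, mul_one]
    rw [Finset.univ_sum_single fun i => (Submodule.Quotient.mk (q i) : K[X] ⧸ _)]
  refine ⟨ι, _, μ, e, x, fun v => ?_, fun q => ?_⟩
  · choose q hq using fun i =>
      Submodule.Quotient.mk_surjective _ (E'.symm (Module.AEval.of K V f v) i)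
    exact ⟨q, by rw [hsum, funext hq, LinearEquiv.apply_symm_apply, LinearEquiv.symm_apply_apply]⟩
  · rw [hsum, LinearEquiv.map_eq_zero_iff, LinearEquiv.map_eq_zero_iff, funext_iff]
    refine forall_congr' fun i => (Submodule.Quotient.mk_eq_zero _).trans ?_
    rw [(hμ i).pow_pow.dvd_iff_dvd_left, ← Ideal.mem_span_singleton, Ideal.submodule_span_eq]

lemma eq_zero_of_X_sub_C_pow_dvd_sum {m : ℕ} {z : K} {α : Fin m → K}
    (h : (X - C z) ^ m ∣ ∑ a, C (α a) * (X - C z) ^ (a.rev : ℕ)) : α = 0 := by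
  have hX : X ^ m ∣ ∑ a, C (α a) * X ^ (a.rev : ℕ) := by
    obtain ⟨q, hq⟩ := h
    have hcomp := congrArg (comp · (X + C z)) hq
    simp only [Polynomial.sum_comp, Polynomial.mul_comp, pow_comp, sub_comp, X_comp, C_comp,
      add_sub_cancel_right] at hcomp
    exact ⟨_, hcomp⟩
  funext a
  have hcoeff := X_pow_dvd_iff.1 hX a.rev a.rev.2
  simpa only [finsetSum_coeff, coeff_C_mul_X_pow, Fin.val_inj, Fin.rev_inj, Finset.sum_ite_eq,
    Finset.mem_univ, if_true, Pi.zero_apply] using hcoeff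

namespace IsCyclicDecomp

/-- The vectors `(f - μ i) ^ c (x i)`, numbered so that those with a fixed `i` form a Jordan chain
starting with an eigenvector. -/
noncomputable def chain (f : Module.End K V) (μ : ι → K) (e : ι → ℕ) (x : ι → V)
    (p : Σ i, Fin (e i)) : V :=
  aeval f ((X - C (μ p.1)) ^ (p.2.rev : ℕ)) (x p.1)

variable {μ : ι → K} {e : ι → ℕ} {x : ι → V}

lemma aeval_pow_eq_zero [Fintype ι] (h : IsCyclicDecomp f μ e x) {i : ι} {c : ℕ} (hc : e i ≤ c) :
    aeval f ((X - C (μ i)) ^ c) (x i) = 0 := by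
  classical
  have := (h.sum_eq_zero_iff (Pi.single i ((X - C (μ i)) ^ c))).2 fun j => ?_
  · rwa [Finset.sum_eq_single i (fun j _ hj => by rw [Pi.single_eq_of_ne hj, map_zero]; rfl)
      (by simp), Pi.single_eq_same] at this
  · obtain rfl | hj := eq_or_ne j i
    · rw [Pi.single_eq_same]
      exact pow_dvd_pow _ hc
    · rw [Pi.single_eq_of_ne hj]
      exact dvd_zero _

lemma linearIndependent_chain [Fintype ι] (h : IsCyclicDecomp f μ e x) :
    LinearIndependent K (chain f μ e x) := by
  refine Fintype.linearIndependent_iff.2 fun α hα => ?_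
  have hsum (i : ι) : ∑ a, α ⟨i, a⟩ • chain f μ e x ⟨i, a⟩ =
      aeval f (∑ a, C (α ⟨i, a⟩) * (X - C (μ i)) ^ (a.rev : ℕ)) (x i) := by
    simp only [chain, map_sum, LinearMap.sum_apply, ← smul_eq_C_mul, map_smul, LinearMap.smul_apply]
  simp only [Fintype.sum_sigma, hsum] at hα
  rintro ⟨i, a⟩
  exact congrFun (eq_zero_of_X_sub_C_pow_dvd_sum ((h.sum_eq_zero_iff _).1 hα i)) a

lemma aeval_mem_span_chain [Fintype ι] (h : IsCyclicDecomp f μ e x) (i : ι) (q : K[X]) :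
    aeval f q (x i) ∈ Submodule.span K (Set.range (chain f μ e x)) := by
  rw [← sum_taylor_eq q (μ i), Polynomial.sum, map_sum, LinearMap.sum_apply]
  refine Submodule.sum_mem _ fun c _ => ?_
  rw [← smul_eq_C_mul, map_smul, LinearMap.smul_apply]
  refine Submodule.smul_mem _ _ ?_
  rcases lt_or_ge c (e i) with hc | hc
  · exact Submodule.subset_span ⟨⟨i, Fin.rev ⟨c, hc⟩⟩, by rw [chain, Fin.rev_rev]⟩
  · rw [h.aeval_pow_eq_zero hc]
    exact Submodule.zero_mem _

lemma span_chain [Fintype ι] (h : IsCyclicDecomp f μ e x) :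
    Submodule.span K (Set.range (chain f μ e x)) = ⊤ := by
  refine Submodule.eq_top_iff'.2 fun v => ?_
  obtain ⟨q, rfl⟩ := h.exists_sum_eq v
  exact Submodule.sum_mem _ fun i _ => h.aeval_mem_span_chain i (q i)

lemma apply_aeval_pow (f : Module.End K V) (z : K) (c : ℕ) (v : V) :
    f (aeval f ((X - C z) ^ c) v) =
      z • aeval f ((X - C z) ^ c) v + aeval f ((X - C z) ^ (c + 1)) v := by
  rw [pow_succ', map_mul, Module.End.mul_apply, map_sub, aeval_X, aeval_C, LinearMap.sub_apply,
    Module.algebraMap_end_apply, add_sub_cancel]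

lemma apply_chain_zero [Fintype ι] (h : IsCyclicDecomp f μ e x) {i : ι} (hi : 0 < e i) :
    f (chain f μ e x ⟨i, 0, hi⟩) = μ i • chain f μ e x ⟨i, 0, hi⟩ := by
  have hle : e i ≤ (Fin.rev ⟨0, hi⟩ : Fin (e i)) + 1 := Nat.le_add_of_sub_le le_rfl
  rw [chain, apply_aeval_pow, h.aeval_pow_eq_zero hle, add_zero]

lemma apply_chain_succ (f : Module.End K V) (μ : ι → K) (e : ι → ℕ) (x : ι → V) {i : ι} {a : ℕ}
    (ha : a + 1 < e i) :
    f (chain f μ e x ⟨i, a + 1, ha⟩) =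
      μ i • chain f μ e x ⟨i, a + 1, ha⟩ + chain f μ e x ⟨i, a, Nat.lt_of_succ_lt ha⟩ := by
  have hrev : e i - (a + 1 + 1) + 1 = e i - (a + 1) := by omega
  simp only [chain, apply_aeval_pow, Fin.val_rev, hrev]

end IsCyclicDecomp

end CyclicDecomposition

section JordanFormExistence

lemma exists_antitone_equiv_pos {ι : Type*} [Finite ι] (e : ι → ℕ) :
    ∃ (u : ℕ) (ρ : Fin u ≃ {i // 0 < e i}), Antitone fun j => e (ρ j) := by
  obtain ⟨u, ⟨σ⟩⟩ := Finite.exists_equiv_fin {i // 0 < e i}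
  let size (j : Fin u) : ℕᵒᵈ := OrderDual.toDual (e (σ.symm j))
  exact ⟨u, (Tuple.sort size).trans σ.symm, Tuple.monotone_sort size⟩

variable {n : ℕ} {A : Matrix (Fin n) (Fin n) ℂ}

theorem exists_isJordanBasis_top (A : Matrix (Fin n) (Fin n) ℂ) :
    ∃ (u : ℕ) (s : Fin u → ℕ) (b : BlockIdx s → Fin n → ℂ),
      (∀ j, 0 < s j) ∧ Antitone s ∧ IsJordanBasis A ⊤ s b := by
  obtain ⟨ι, _, μ, e, x, h⟩ := exists_isCyclicDecomp (toLin' A)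
  obtain ⟨u, ρ, hρ⟩ := exists_antitone_equiv_pos e
  let θ : BlockIdx (fun j => e (ρ j)) ≃ Σ i, Fin (e i) :=
    (Equiv.sigmaCongrLeft (β := fun i : {i // 0 < e i} => Fin (e i)) ρ).trans
      (Equiv.sigmaSubtypeEquivOfSubset (fun i => Fin (e i)) _ fun _ => Fin.pos)
  refine ⟨u, _, IsCyclicDecomp.chain (toLin' A) μ e x ∘ θ, fun j => (ρ j).2, hρ,
    h.linearIndependent_chain.comp _ θ.injective, ?_, fun j => μ (ρ j), fun j => ⟨fun _ => ?_, ?_⟩⟩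
  · rw [θ.surjective.range_comp, h.span_chain]
  · exact h.apply_chain_zero _
  · exact fun _ => IsCyclicDecomp.apply_chain_succ (toLin' A) μ e x

open BlockSeq in
lemma exists_eq_mul_jordanMatrix_mul {u : ℕ} {s : Fin u → ℕ} {μ : Fin u → ℂ}
    {ψ : (Fin n → ℂ) →ₗ[ℂ] BlockSeq ℂ (Fin u)} (h : IsCoord (toLin' A) s μ ψ) :
    ∃ (X : Matrix (Fin n) (BlockIdx s) ℂ) (Y : Matrix (BlockIdx s) (Fin n) ℂ),
      X * Y = 1 ∧ Y * X = 1 ∧ A = X * jordanMatrix s μ * Y := by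
  have hext := isCoord_ext s μ
  let L : (Fin n → ℂ) ≃ₗ[ℂ] (BlockIdx s → ℂ) := (LinearEquiv.ofInjective ψ h.injective).trans <|
    (LinearEquiv.ofEq _ _ (h.range_eq.trans hext.range_eq.symm)).trans
      (LinearEquiv.ofInjective (ext s) hext.injective).symm
  have hL (v : Fin n → ℂ) : ext s (L v) = ψ v :=
    congrArg Subtype.val ((LinearEquiv.ofInjective (ext s) hext.injective).apply_symm_apply _)
  have hA : toLin' A = L.symm.toLinearMap ∘ₗ toLin' (jordanMatrix s μ) ∘ₗ L.toLinearMap := by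
    refine LinearMap.ext fun v => L.injective <| hext.injective ?_
    rw [hL, h.map_apply, LinearMap.comp_apply, LinearEquiv.coe_coe, L.apply_symm_apply,
      LinearMap.comp_apply, hext.map_apply, LinearEquiv.coe_coe, hL]
  refine ⟨LinearMap.toMatrix' L.symm.toLinearMap, LinearMap.toMatrix' L.toLinearMap, ?_, ?_, ?_⟩
  · rw [← LinearMap.toMatrix'_comp, LinearEquiv.symm_comp, LinearMap.toMatrix'_id]
  · rw [← LinearMap.toMatrix'_comp, LinearEquiv.comp_symm, LinearMap.toMatrix'_id]
  · rw [← LinearMap.toMatrix'_toLin' A, hA, LinearMap.toMatrix'_comp, LinearMap.toMatrix'_comp,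
      LinearMap.toMatrix'_toLin', Matrix.mul_assoc]

theorem nonempty_jordanForm (A : Matrix (Fin n) (Fin n) ℂ) : Nonempty (JordanForm A) := by
  obtain ⟨u, s, b, hpos, hanti, hb⟩ := exists_isJordanBasis_top A
  obtain ⟨μ, ψ, hψ, -⟩ := BlockSeq.exists_isCoord_of_isJordanBasis hb
  obtain ⟨X, Y, hXY, hYX, hA⟩ := exists_eq_mul_jordanMatrix_mul hψ
  exact ⟨⟨u, s, μ, hpos, fun i j hij _ => hanti hij, X, Y, hXY, hYX, hA⟩⟩

end JordanFormExistence

theorem theoremB (n : ℕ) (A : Matrix (Fin n) (Fin n) ℂ) :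
    Nonempty (JordanForm A) ∧ ∀ F : JordanForm A,
      -- every invariant subspace, and nothing else, is constructed in the expanded space
      (∀ N : Submodule ℂ (Fin n → ℂ), N ∈ invariantLattice A ↔
        ∃ k ≤ F.size, ∃ T, F.Represents Set.univ k T N) ∧
      -- the marked ones are exactly those constructed without any expansion
      (∀ N : Submodule ℂ (Fin n → ℂ), (N ∈ invariantLattice A ∧ IsMarked A N) ↔
        ∃ k ≤ F.size, ∃ T, F.Represents ∅ k T N) ∧
      -- the matrices `Z` form a lattice: order is comparison of the powers
      (∃ Θ : Set.Iic F.size ≃o F.ZMatrix,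
        ∀ k, (Θ k).1 = shiftMatrix (F.expandedSize Set.univ) k.1) ∧
      -- the correspondence of types of invariant subspaces with the lattice of matrices `Z`
      (∃ Φ : F.InvType ≃o F.ZMatrix, ∀ (N : invariantLattice A) (k : Fin F.u → ℕ), k ≤ F.size →
        ((∃ T, F.Represents Set.univ k T N.1) ↔
          (Φ (Quotient.mk _ N)).1 = shiftMatrix (F.expandedSize Set.univ) k)) ∧
      -- the sum of the powers is the dimension
      (∀ N ∈ invariantLattice A, ∑ i, F.chainLength N i = Module.finrank ℂ N) ∧
      -- the lattice of powers lifts to a lattice of marked invariant subspaces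
      (∃ ψ : LatticeHom (Set.Iic F.size) (invariantLattice A),
        ∀ k, F.Produces (ψ k).1 ⟨F.size, shiftMatrix F.size k.1⟩) ∧
      -- below an invariant subspace all smaller powers occur
      (∀ N ∈ invariantLattice A, ∀ k ≤ F.chainLength N,
        ∃ N' ∈ invariantLattice A, N' ≤ N ∧ F.chainLength N' = k) ∧
      -- above a marked invariant subspace all larger powers occur
      (∀ N ∈ invariantLattice A, IsMarked A N → ∀ k, F.chainLength N ≤ k → k ≤ F.size →
        ∃ N' ∈ invariantLattice A, N ≤ N' ∧ IsMarked A N' ∧ F.chainLength N' = k) ∧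
      -- the correspondence when blocks are expanded only where the subspace is not marked
      (∃ Φ : Quotient F.refinedSetoid ≃ F.zList, ∀ (N : invariantLattice A) Z,
        F.Produces N.1 Z ↔ (Φ (Quotient.mk _ N)).1 = Z) ∧
      -- the sublattice of hyperinvariant subspaces
      (∀ N : Submodule ℂ (Fin n → ℂ), N ∈ hyperinvariantLattice A ↔
        ∃ r ∈ F.hyperPowers, N ∈ invariantLattice A ∧
          F.Produces N ⟨F.size, shiftMatrix F.size r⟩) ∧
      (∃ Ψ : hyperinvariantLattice A ≃o F.hyperPowers,
        ∀ N, F.Produces N.1 ⟨F.size, shiftMatrix F.size (Ψ N).1⟩) := by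
  refine ⟨nonempty_jordanForm A, fun F => ⟨fun _ => F.mem_invariantLattice_iff,
    fun _ => F.isMarked_iff_exists_represents, ⟨F.powersOrderIso, F.powersOrderIso_apply⟩,
    ⟨_, fun N _ hk => F.exists_represents_iff_powersOrderIso_typesOrderIso N hk⟩,
    fun _ hN => (F.sum_chainLength hN).symm,
    ⟨F.initialHom, fun k => F.produces_initial k.2⟩,
    fun _ hN _ hk => F.exists_le_chainLength_eq hN hk,
    fun _ hN hm _ hk hks => F.exists_ge_isMarked_chainLength_eq hN hm hk hks,
    ⟨F.refinedTypesEquiv, F.produces_iff_refinedTypesEquiv⟩,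
    fun _ => F.mem_hyperinvariantLattice_iff,
    ⟨F.hyperinvariantOrderIso, fun N => F.produces_of_mem_hyperinvariantLattice N.2⟩⟩⟩
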